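/- Let $\Omega\subset\mathbb R^d$ be a bounded open set, let $A$ be the Laplacian on $L^2(\Omega)$ with zero Dirichlet boundary condition (with domain $D(A)=\{u\in H^1_0(\Omega):\Delta u\in L^2(\Omega)\}$, $\Delta u$ in the weak sense), let $\|\cdot\|$ be the norm of $L^2(\Omega)$, and let $T,\kappa>0$. Let $\alpha:[0,T]\to(1,2)$ be three times differentiable with $|\alpha'|+|\alpha''|+|\alpha'''|\le L$ on $[0,T]$ for some $L>0$, and assume $\alpha'(0)=\alpha''(0)=0$. Put $\alpha_0=\alpha(0)$, $\bar\alpha=\alpha_0-1$, $\beta_{\bar\alpha}(t)=t^{\bar\alpha-1}/\Gamma(\bar\alpha)$ and $$g(t)=\int_0^1\frac{(tz)^{\alpha_0-\alpha(tz)}}{\Gamma(\alpha_0-1)\,\Gamma(2-\alpha(tz))}(1-z)^{\alpha_0-2}z^{1-\alpha_0}\,dz \quad (0\le t\le T),\qquad\text{where } g(0)=1 .$$ For $u_0\in D(A)$, $\bar u_0\in L^2(\Omega)$ and $f\in C([0,T];L^2(\Omega))$ let $$\mathcal F(t)=\int_0^t\beta_{\bar\alpha}(t-s)\,\bigl(\kappa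 A u_0+f(s)\bigr)\,ds+g(t)\,\bar u_0 .$$ For an integer $N\ge1$ let $\tau=T/N$, $t_n=n\tau$, $\delta_t v^n=(v^n-v^{n-1})/\tau$, $\delta_t^{(2)}v^n=\tfrac32\delta_t v^n-\tfrac12\delta_t v^{n-1}$ and $w_k=g(t_{k+1})-g(t_k)$. Let $\chi_j$ be defined by $\bigl[\tfrac{(1-\zeta)(3-\zeta)}2\bigr]^{-\bar\alpha}=\sum_{j\ge0}\chi_j\zeta^j$, and let $\omega_n=\frac{n^{\bar\alpha}}{\Gamma(\bar\alpha+1)}-\sum_{j=1}^n\chi_{n-j}$. Let $\widetilde U^0=0$, and let $\widetilde U^1,\dots,\widetilde U^N\in D(A)$ solve the semi-discrete scheme $$\delta_t\widetilde U^1+w_0\,\delta_t\widetilde U^1-\kappa\tau^{\bar\alpha}\bigl(\chi_0A\widetilde U^1+\omega_1A\widetilde U^0\bigr)=\mathcal F(t_1),$$ $$\delta_t^{(2)}\widetilde U^n+\sum_{k=1}^nw_{n-k}\,\delta_t\widetilde U^k-\kappa\tau^{\bar\alpha}\Bigl(\sum_{j=1}^n\chi_{n-j}A\widetilde U^j+\omega_nA\widetilde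 U^0\Bigr)=\mathcal F(t_n),\qquad 2\le n\le N .$$ **Theorem.** There are constants $Q_1,Q_2>0$, depending only on $\Omega$, $T$, $\kappa$ and $\alpha$ (and thus not on $N$, $\tau$, $m$, $u_0$, $\bar u_0$, $f$), such that for all such data, every $N\ge1$ and all $1\le m\le N$ $$\|\widetilde U^m\|\le Q_1\sum_{n=1}^m\tau\,\|\mathcal F(t_n)\|\le Q_2\Bigl(\|Au_0\|+\|\bar u_0\|+\max_{0\le t\le t_m}\|f(t)\|\Bigr).$$ -/

import Mathlib

open MeasureTheory Set
open scoped ContDiff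

noncomputable section

namespace VarExpWave

/-! ### The Dirichlet Laplacian on `L²(Ω)` -/

/-- The real Hilbert space `L²(Ω)` of an open set `Ω ⊆ ℝ^d`. -/
abbrev L2 {d : ℕ} (Ω : Set (EuclideanSpace ℝ (Fin d))) : Type :=
  Lp ℝ 2 (volume.restrict Ω)

/-- The space `C₀^∞(Ω)` of test functions. -/
structure IsTestFunction {d : ℕ} (Ω : Set (EuclideanSpace ℝ (Fin d)))
    (φ : EuclideanSpace ℝ (Fin d) → ℝ) : Prop where
  smooth : ContDiff ℝ ∞ φ
  compact : HasCompactSupport φ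
  supp : tsupport φ ⊆ Ω

/-- The classical partial derivative `∂ᵢφ`. -/
def partialDeriv {d : ℕ} (i : Fin d) (φ : EuclideanSpace ℝ (Fin d) → ℝ)
    (x : EuclideanSpace ℝ (Fin d)) : ℝ :=
  fderiv ℝ φ x (EuclideanSpace.single i 1)

/-- `G ∈ L²(Ω)^d` is the weak gradient of `u ∈ L²(Ω)`; thus `u ∈ H¹(Ω)`. -/
def HasWeakGradient {d : ℕ} (Ω : Set (EuclideanSpace ℝ (Fin d))) (u : L2 Ω)
    (G : Fin d → L2 Ω) : Prop :=
  ∀ φ, IsTestFunction Ω φ → ∀ i : Fin d,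
    ∫ x in Ω, u x * partialDeriv i φ x = -∫ x in Ω, G i x * φ x

/-- `u` belongs to `H¹₀(Ω)`, the closure of `C₀^∞(Ω)` in `H¹(Ω)`, and `G` is its weak gradient. -/
def MemH10WithGradient {d : ℕ} (Ω : Set (EuclideanSpace ℝ (Fin d))) (u : L2 Ω)
    (G : Fin d → L2 Ω) : Prop :=
  HasWeakGradient Ω u G ∧
    ∀ ε : ℝ, 0 < ε → ∃ φ, IsTestFunction Ω φ ∧
      eLpNorm (fun x => u x - φ x) 2 (volume.restrict Ω) < ENNReal.ofReal ε ∧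
      ∀ i : Fin d, eLpNorm (fun x => G i x - partialDeriv i φ x) 2 (volume.restrict Ω)
        < ENNReal.ofReal ε

/-- `u` is in the domain of the Laplacian `A` on `L²(Ω)` with zero boundary condition, and
`A u = v`: that is, `u ∈ H¹₀(Ω)`, and the weak divergence of `∇u` is `v ∈ L²(Ω)`. -/
def IsDirichletLaplacian {d : ℕ} (Ω : Set (EuclideanSpace ℝ (Fin d))) (u v : L2 Ω) : Prop :=
  ∃ G : Fin d → L2 Ω, MemH10WithGradient Ω u G ∧
    ∀ φ, IsTestFunction Ω φ →
      ∑ i : Fin d, ∫ x in Ω, G i x * partialDeriv i φ x = -∫ x in Ω, v x * φ x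

/-- An element of `L²(Ω)` is determined by its integrals against test functions. -/
theorem L2_ext_of_test {d : ℕ} {Ω : Set (EuclideanSpace ℝ (Fin d))} (hΩ : IsOpen Ω)
    {v v' : L2 Ω}
    (h : ∀ φ, IsTestFunction Ω φ → ∫ x in Ω, v x * φ x = ∫ x in Ω, v' x * φ x) : v = v' := by
  have hloc : ∀ w : L2 Ω, LocallyIntegrable w (volume.restrict Ω) := fun w =>
    (Lp.memLp w).locallyIntegrable (by norm_num)
  have hint : ∀ (w : L2 Ω) φ, IsTestFunction Ω φ →
      Integrable (fun x => φ x • w x) (volume.restrict Ω) := fun w φ hφ =>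
    (hloc w).integrable_smul_left_of_hasCompactSupport hφ.smooth.continuous hφ.compact
  have key : ∀ᵐ x ∂(volume.restrict Ω), x ∈ Ω → (v x - v' x) = 0 := by
    refine hΩ.ae_eq_zero_of_integral_contDiff_smul_eq_zero
      (((hloc v).sub (hloc v')).locallyIntegrableOn Ω) ?_
    intro φ h1 h2 h3
    have hφ : IsTestFunction Ω φ := ⟨h1, h2, h3⟩
    have := h φ hφ
    simp only [smul_sub]
    rw [integral_sub (hint v φ hφ) (hint v' φ hφ)]
    simp only [smul_eq_mul, mul_comm (φ _)]
    linarith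
  refine Lp.ext ?_
  filter_upwards [key, ae_restrict_mem hΩ.measurableSet] with x hx hx'
  exact sub_eq_zero.1 (hx hx')

/-- The value `A u` is unique, so that `A` is an operator on its domain. -/
theorem IsDirichletLaplacian.unique {d : ℕ} {Ω : Set (EuclideanSpace ℝ (Fin d))}
    (hΩ : IsOpen Ω) {u v v' : L2 Ω} (h : IsDirichletLaplacian Ω u v)
    (h' : IsDirichletLaplacian Ω u v') : v = v' := by
  obtain ⟨G, hG, hv⟩ := h
  obtain ⟨G', hG', hv'⟩ := h'
  have hGG : G = G' := funext fun i => L2_ext_of_test hΩ fun φ hφ => by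
    have h1 := hG.1 φ hφ i
    have h2 := hG'.1 φ hφ i
    linarith
  subst hGG
  refine L2_ext_of_test hΩ fun φ hφ => ?_
  have h1 := hv φ hφ
  have h2 := hv' φ hφ
  linarith

/-! ### The variable exponent and the kernels -/

/-- `α` maps `[0,T]` to `(1,2)` and is three times differentiable on `[0,T]`
(one-sidedly at the end points) with `|α'| + |α''| + |α'''| ≤ L` for some `L > 0`. -/
structure IsAdmissibleExponent (T : ℝ) (α : ℝ → ℝ) : Prop where
  mem_Ioo : ∀ t ∈ Icc 0 T, α t ∈ Ioo (1 : ℝ) 2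
  differentiableOn : ∀ j : ℕ, j < 3 →
    DifferentiableOn ℝ (iteratedDerivWithin j α (Icc 0 T)) (Icc 0 T)
  bounded : ∃ L : ℝ, 0 < L ∧ ∀ t ∈ Icc 0 T,
    |iteratedDerivWithin 1 α (Icc 0 T) t| + |iteratedDerivWithin 2 α (Icc 0 T) t|
      + |iteratedDerivWithin 3 α (Icc 0 T) t| ≤ L

/-- The Abel kernel `β_μ(t) = t^(μ-1) / Γ(μ)`. -/
def abelKernel (μ t : ℝ) : ℝ := t ^ (μ - 1) / Real.Gamma μ

/-- The generalized identity function `g`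
(for `t = 0` the factor `(tz)^(α(0)-α(tz))` is `0^0 = 1`, so that `g(0) = 1`). -/
def genId (α : ℝ → ℝ) (t : ℝ) : ℝ :=
  ∫ z in (0 : ℝ)..1, (t * z) ^ (α 0 - α (t * z))
    / (Real.Gamma (α 0 - 1) * Real.Gamma (2 - α (t * z)))
    * (1 - z) ^ (α 0 - 2) * z ^ (1 - α 0)

/-- The right-hand side
`𝓕(t) = ∫₀ᵗ β_ᾱ(t-s) (κ A u₀ + f(s)) ds + g(t) ū₀` with `ᾱ = α(0) - 1`; `Au₀` stands for `A u₀`. -/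
def rhs {d : ℕ} {Ω : Set (EuclideanSpace ℝ (Fin d))} (κ : ℝ) (α : ℝ → ℝ)
    (Au₀ ubar₀ : L2 Ω) (f : ℝ → L2 Ω) (t : ℝ) : L2 Ω :=
  (∫ s in (0 : ℝ)..t, abelKernel (α 0 - 1) (t - s) • (κ • Au₀ + f s)) + genId α t • ubar₀

/-! ### The time discretization -/

/-- `δ_t vⁿ = (vⁿ - vⁿ⁻¹) / τ` for `n ≥ 1`. -/
def diffQuot {E : Type*} [AddCommGroup E] [Module ℝ E] (τ : ℝ) (v : ℕ → E) (n : ℕ) : E :=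
  τ⁻¹ • (v n - v (n - 1))

/-- `δ_t^(2) vⁿ = (3/2) δ_t vⁿ - (1/2) δ_t vⁿ⁻¹` for `n ≥ 2`. -/
def bdf2 {E : Type*} [AddCommGroup E] [Module ℝ E] (τ : ℝ) (v : ℕ → E) (n : ℕ) : E :=
  (3 / 2 : ℝ) • diffQuot τ v n - (1 / 2 : ℝ) • diffQuot τ v (n - 1)

/-- `w_k = g(t_{k+1}) - g(t_k)` with `t_k = k τ`. -/
def wgt (α : ℝ → ℝ) (τ : ℝ) (k : ℕ) : ℝ :=
  genId α ((k + 1 : ℕ) * τ) - genId α ((k : ℝ) * τ)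

/-- `c_n^(μ) = (-1)ⁿ binom(-μ, n)`, the Taylor coefficients of `(1 - ζ)^(-μ)`. -/
def binomCoeff (μ : ℝ) (n : ℕ) : ℝ := (-1) ^ n * Ring.choose (-μ) n

/-- The convolution quadrature weights `χ_n^(μ)`, the Taylor coefficients of
`((1 - ζ)(3 - ζ)/2)^(-μ)`. -/
def cqWeight (μ : ℝ) (n : ℕ) : ℝ :=
  (2 / 3 : ℝ) ^ μ *
    ∑ j ∈ Finset.range (n + 1), ((3 : ℝ) ^ j)⁻¹ * binomCoeff μ (n - j) * binomCoeff μ j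

/-- The correction weights `ω_n^(μ) = n^μ / Γ(μ+1) - ∑_{j=1}^n χ_{n-j}^(μ)`. -/
def corrWeight (μ : ℝ) (n : ℕ) : ℝ :=
  (n : ℝ) ^ μ / Real.Gamma (μ + 1) - ∑ j ∈ Finset.Icc 1 n, cqWeight μ (n - j)

/-- `U⁰, …, U^N` is a solution of the semi-discrete scheme with right-hand side `F`, where
`τ = T/N` and `tₙ = n τ`; `AU n` stands for `A Uⁿ`. -/
structure IsSchemeSolution {d : ℕ} (Ω : Set (EuclideanSpace ℝ (Fin d))) (T κ : ℝ) (α : ℝ → ℝ)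
    (N : ℕ) (F : ℝ → L2 Ω) (U AU : ℕ → L2 Ω) : Prop where
  laplacian : ∀ n ≤ N, IsDirichletLaplacian Ω (U n) (AU n)
  initial : U 0 = 0
  first :
    diffQuot (T / N) U 1 + wgt α (T / N) 0 • diffQuot (T / N) U 1
      - (κ * (T / N) ^ (α 0 - 1)) •
        (∑ j ∈ Finset.Icc 1 1, cqWeight (α 0 - 1) (1 - j) • AU j
          + corrWeight (α 0 - 1) 1 • AU 0) = F (T / N)
  step : ∀ n : ℕ, 2 ≤ n → n ≤ N →
    bdf2 (T / N) U n + ∑ k ∈ Finset.Icc 1 n, wgt α (T / N) (n - k) • diffQuot (T / N) U k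
      - (κ * (T / N) ^ (α 0 - 1)) •
        (∑ j ∈ Finset.Icc 1 n, cqWeight (α 0 - 1) (n - j) • AU j
          + corrWeight (α 0 - 1) n • AU 0) = F (n * (T / N))

end VarExpWave

end

namespace VarExpWave

open Filter Topology RealInnerProductSpace

/-! ### The convolution quadrature weights are of positive type -/

/-! The estimate is an energy argument. After multiplication by `τ` and summation by parts (recall
`U⁰ = 0`, so also `A U⁰ = 0` and the correction terms vanish), the scheme is tested with `Uⁿ` and
summed over `n`. Three facts carry it. The BDF2 difference is G-stable (`inner_bdf2_ge`), so its sum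
controls `‖Uᵐ‖²/4` up to the starting value. The fractional term has the good sign: Green's formula
turns it into a discrete convolution of gradients, and the weights `χ` are of positive type because
their generating function has nonnegative real part in the unit disc, which combines the A-stability
of BDF2 with `0 < ᾱ < 1`. The memory term is a perturbation of size `O(τ) max ‖Uᵏ‖`, because the
first and second differences of `g` are `O(τ)` and `O(τ²)`; here `α'(0) = α''(0) = 0` is used, which
makes `(α(s) - α(0)) log s` twice differentiable with bounded derivatives. A discrete Gronwall
inequality finishes the proof when `τ` is small (`stability_of_small_step`). Only finitely many
coarse grids remain. For each of them a separate induction over the steps gives a constant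
independent of the operator (`stability_of_fixed_length`); it needs only that the diagonal
coefficients are positive, which follows from `g > 0`. The second inequality of the theorem bounds
`𝓕` pointwise, through the integral of the Abel kernel and the bound on `g`. -/

theorem hasSum_binomCoeff (μ : ℝ) {z : ℂ} (hz : ‖z‖ < 1) :
    HasSum (fun n => (binomCoeff μ n : ℂ) * z ^ n) ((1 - z) ^ (-(μ : ℂ))) := by
  have h := (Complex.one_add_cpow_hasFPowerSeriesOnBall_zero (a := -(μ : ℂ))).hasSum
    (y := -z) (by rw [← ENNReal.ofReal_one, Metric.eball_ofReal]; simpa using hz)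
  rw [zero_add, ← sub_eq_add_neg] at h
  refine h.congr_fun fun n => ?_
  rw [binomialSeries_apply]
  simp [binomCoeff, Complex.ofReal_choose, neg_pow z n]
  ring

/-- Cauchy product for the factorization `(1 - z)(3 - z)/2 = (3/2)(1 - z)(1 - z/3)`. The two powers
stay separate because each base lies in the right half plane, where the principal branch is
harmless. -/
theorem hasSum_cqWeight (μ : ℝ) {z : ℂ} (hz : ‖z‖ < 1) :
    HasSum (fun n => (cqWeight μ n : ℂ) * z ^ n)
      (((2 / 3 : ℝ) ^ μ : ℝ) * ((1 - z) ^ (-(μ : ℂ)) * (1 - z / 3) ^ (-(μ : ℂ)))) := by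
  have hz3 : ‖z / 3‖ < 1 := by
    rw [norm_div]; norm_num; linarith [norm_nonneg z]
  have h1 := hasSum_binomCoeff μ hz
  have h2 := hasSum_binomCoeff μ hz3
  have h1n := h1.summable.norm
  have h2n := h2.summable.norm
  have hs := (summable_norm_sum_mul_range_of_summable_norm h2n h1n).of_norm
  have ht := tsum_mul_tsum_eq_tsum_sum_range_of_summable_norm h2n h1n
  have h3 := hs.hasSum
  rw [← ht, h1.tsum_eq, h2.tsum_eq, mul_comm] at h3
  refine (h3.mul_left (((2 / 3 : ℝ) ^ μ : ℝ) : ℂ)).congr_fun fun n => ?_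
  rw [cqWeight]
  push_cast
  rw [mul_assoc, Finset.sum_mul]
  congr 1
  refine Finset.sum_congr rfl fun j hj => ?_
  have hj' : j ≤ n := Nat.lt_succ_iff.1 (Finset.mem_range.1 hj)
  conv_lhs => rw [← Nat.sub_add_cancel hj', pow_add]
  rw [Nat.sub_add_cancel hj', div_pow]
  field_simp

theorem abs_mul_le_of_cos_pos {s μ : ℝ} (hs : |s| < Real.pi) (hc : 0 < Real.cos s)
    (h0 : 0 ≤ μ) (h1 : μ ≤ 1) : |μ * s| ≤ Real.pi / 2 := by
  have : |s| < Real.pi / 2 := by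
    by_contra! h
    have := Real.cos_nonpos_of_pi_div_two_le_of_le h (by linarith [Real.pi_pos])
    rw [Real.cos_abs] at this
    linarith
  rw [abs_mul, abs_of_nonneg h0]
  nlinarith [abs_nonneg s]

/-- The arguments of `a` and `b` add up to an angle in `(-π, π)`. Positivity of `Re (ab)` confines
it to `(-π/2, π/2)`, and multiplication by `-μ` with `0 ≤ μ ≤ 1` does not enlarge its modulus. -/
theorem re_cpow_mul_cpow_nonneg {μ : ℝ} (h0 : 0 ≤ μ) (h1 : μ ≤ 1) {a b : ℂ}
    (ha : 0 < a.re) (hb : 0 < b.re) (hab : 0 < (a * b).re) :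
    0 ≤ (a ^ (-(μ : ℂ)) * b ^ (-(μ : ℂ))).re := by
  have ha0 : a ≠ 0 := fun h => by simp [h] at ha
  have hb0 : b ≠ 0 := fun h => by simp [h] at hb
  have hs : |a.arg + b.arg| < Real.pi := by
    have h1 := Complex.abs_arg_lt_pi_div_two_iff.2 (Or.inl ha)
    have h2 := Complex.abs_arg_lt_pi_div_two_iff.2 (Or.inl hb)
    linarith [abs_add_le a.arg b.arg]
  have hc : 0 < Real.cos (a.arg + b.arg) := by
    have h : a * b = Complex.exp (Complex.log a + Complex.log b) := by
      rw [Complex.exp_add, Complex.exp_log ha0, Complex.exp_log hb0]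
    rw [h, Complex.exp_re, Complex.add_im, Complex.log_im, Complex.log_im] at hab
    exact pos_of_mul_pos_right hab (Real.exp_pos _).le
  have hm := abs_mul_le_of_cos_pos hs hc h0 h1
  rw [Complex.cpow_def_of_ne_zero ha0, Complex.cpow_def_of_ne_zero hb0, ← Complex.exp_add,
    Complex.exp_re]
  refine mul_nonneg (Real.exp_pos _).le ?_
  have : (Complex.log a * -(μ : ℂ) + Complex.log b * -(μ : ℂ)).im = -(μ * (a.arg + b.arg)) := by
    simp [Complex.log_im]
    ring
  rw [this, Real.cos_neg]
  exact Real.cos_nonneg_of_mem_Icc (abs_le.1 hm)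

/-- The sum is the real part of the generating function at `r e^{iθ}`. -/
theorem tsum_cqWeight_cos_nonneg {μ : ℝ} (h0 : 0 ≤ μ) (h1 : μ ≤ 1) {r : ℝ} (hr0 : 0 ≤ r)
    (hr1 : r < 1) (θ : ℝ) : ∃ S : ℝ, 0 ≤ S ∧
      HasSum (fun k => cqWeight μ k * r ^ k * Real.cos (k * θ)) S := by
  set z : ℂ := r * Complex.exp (θ * Complex.I) with hz
  have hzn : ‖z‖ < 1 := by
    rw [hz, norm_mul, Complex.norm_exp_ofReal_mul_I, mul_one, Complex.norm_real, Real.norm_eq_abs,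
      abs_of_nonneg hr0]
    exact hr1
  have hre : z.re = r * Real.cos θ := by simp [hz, Complex.exp_ofReal_mul_I_re]
  have him : z.im = r * Real.sin θ := by simp [hz, Complex.exp_ofReal_mul_I_im]
  have hcr : r * Real.cos θ < 1 := by nlinarith [Real.cos_le_one θ]
  refine ⟨_, ?_, (Complex.hasSum_re (hasSum_cqWeight μ hzn)).congr_fun fun k => ?_⟩
  · rw [Complex.re_ofReal_mul]
    refine mul_nonneg (by positivity) (re_cpow_mul_cpow_nonneg h0 h1 ?_ ?_ ?_)
    · simp [hre, hcr]
    · simp [hre]; linarith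
    -- The A-stability of BDF2: for `|z| < 1` the first term on the right is a square and the second
    -- is positive.
    · have : ((1 - z) * (1 - z / 3)).re = (2 / 3) * ((1 - z.re) ^ 2 + (1 - (z.re ^ 2 + z.im ^ 2)) / 2) := by
        simp
        ring
      rw [this, hre, him]
      have hcs := Real.sin_sq_add_cos_sq θ
      have : (r * Real.cos θ) ^ 2 + (r * Real.sin θ) ^ 2 = r ^ 2 := by
        rw [mul_pow, mul_pow, ← mul_add, add_comm, hcs, mul_one]
      rw [this]
      have : r ^ 2 < 1 := by nlinarith
      nlinarith [sq_nonneg (1 - r * Real.cos θ)]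
  · have : z ^ k = ((r ^ k : ℝ) : ℂ) * Complex.exp ((k * θ : ℝ) * Complex.I) := by
      rw [hz, mul_pow, ← Complex.exp_nat_mul]
      push_cast
      ring_nf
    rw [Complex.re_ofReal_mul, this, Complex.re_ofReal_mul, Complex.exp_ofReal_mul_I_re, mul_assoc]

theorem integral_cos_int_mul (m : ℤ) :
    ∫ θ in (0 : ℝ)..(2 * Real.pi), Real.cos (m * θ) = if m = 0 then 2 * Real.pi else 0 := by
  split_ifs with h
  · simp [h]
  · have h' : (m : ℝ) ≠ 0 := by exact_mod_cast h
    rw [intervalIntegral.integral_comp_mul_left (fun x => Real.cos x) h', integral_cos]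
    have : Real.sin (m * (2 * Real.pi)) = 0 := by
      have := Real.sin_int_mul_pi (m * 2)
      push_cast at this
      rw [← this]; ring_nf
    simp [this]

theorem integral_cos_mul_cos_int (k m : ℤ) :
    ∫ θ in (0 : ℝ)..(2 * Real.pi), Real.cos (k * θ) * Real.cos (m * θ) =
      Real.pi * ((if k = m then 1 else 0) + (if k = -m then 1 else 0)) := by
  have h : ∀ θ : ℝ, Real.cos (k * θ) * Real.cos (m * θ) =
      (1 / 2) * (Real.cos ((k - m : ℤ) * θ) + Real.cos ((k + m : ℤ) * θ)) := fun θ => by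
    push_cast
    rw [sub_mul, add_mul, Real.cos_sub, Real.cos_add]
    ring
  simp_rw [h]
  rw [intervalIntegral.integral_const_mul, intervalIntegral.integral_add
    (Continuous.intervalIntegrable (by fun_prop) _ _)
    (Continuous.intervalIntegrable (by fun_prop) _ _), integral_cos_int_mul, integral_cos_int_mul]
  have e1 : k - m = 0 ↔ k = m := sub_eq_zero
  have e2 : k + m = 0 ↔ k = -m := add_eq_zero_iff_eq_neg
  simp only [e1, e2]
  split_ifs <;> ring

section PositiveType

variable {E : Type*} [NormedAddCommGroup E] [InnerProductSpace ℝ E]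

/-- The double sum is the squared norm of `∑ e^{ijθ} x_j`, split into its cosine and sine parts. -/
theorem sum_inner_mul_cos_nonneg (s : Finset ℕ) (x : ℕ → E) (θ : ℝ) :
    0 ≤ ∑ n ∈ s, ∑ j ∈ s, ⟪x j, x n⟫ * Real.cos (((n : ℤ) - j : ℤ) * θ) := by
  have h : ∑ n ∈ s, ∑ j ∈ s, ⟪x j, x n⟫ * Real.cos (((n : ℤ) - j : ℤ) * θ) =
      ⟪∑ j ∈ s, Real.cos (j * θ) • x j, ∑ n ∈ s, Real.cos (n * θ) • x n⟫ +
      ⟪∑ j ∈ s, Real.sin (j * θ) • x j, ∑ n ∈ s, Real.sin (n * θ) • x n⟫ := by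
    simp only [inner_sum, sum_inner, ← Finset.sum_add_distrib]
    refine Finset.sum_congr rfl fun n _ => Finset.sum_congr rfl fun j _ => ?_
    rw [real_inner_smul_left, real_inner_smul_left, real_inner_smul_right, real_inner_smul_right]
    push_cast
    rw [sub_mul, Real.cos_sub]
    ring
  rw [h]
  exact add_nonneg real_inner_self_nonneg real_inner_self_nonneg

/-- By orthogonality, `k = n - j` and `k = j - n` each contribute `π`. An off-diagonal pair occurs
in both orders, and on the diagonal both cases hold at `k = 0`, so every term receives `2π`. The
condition `m < M` ensures that all indices `n - j` occur. -/
theorem sum_trig_conv_eq_integral (a : ℕ → ℝ) (m M : ℕ) (hM : m < M) (x : ℕ → E) :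
    ∫ θ in (0 : ℝ)..(2 * Real.pi), (∑ k ∈ Finset.range M, a k * Real.cos (k * θ)) *
        ∑ n ∈ Finset.Icc 1 m, ∑ j ∈ Finset.Icc 1 m, ⟪x j, x n⟫ *
          Real.cos (((n : ℤ) - j : ℤ) * θ) =
      2 * Real.pi * ∑ n ∈ Finset.Icc 1 m, ∑ j ∈ Finset.Icc 1 n, a (n - j) * ⟪x j, x n⟫ := by
  have key : ∀ n ∈ Finset.Icc 1 m, ∀ j ∈ Finset.Icc 1 m,
      ∑ k ∈ Finset.range M, a k * (if (k : ℤ) = (n : ℤ) - j then (1 : ℝ) else 0) =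
        if j ≤ n then a (n - j) else 0 := by
    intro n hn j hj
    rw [Finset.mem_Icc] at hn hj
    split_ifs with h
    · rw [Finset.sum_eq_single (n - j)]
      · rw [if_pos (by omega), mul_one]
      · intro b _ hb
        rw [if_neg (by omega), mul_zero]
      · intro h'
        simp at h'
        omega
    · refine Finset.sum_eq_zero fun k _ => ?_
      rw [if_neg (by omega), mul_zero]
  have h1 : ∫ θ in (0 : ℝ)..(2 * Real.pi), (∑ k ∈ Finset.range M, a k * Real.cos (k * θ)) *
        ∑ n ∈ Finset.Icc 1 m, ∑ j ∈ Finset.Icc 1 m, ⟪x j, x n⟫ *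
          Real.cos (((n : ℤ) - j : ℤ) * θ) =
      ∑ n ∈ Finset.Icc 1 m, ∑ j ∈ Finset.Icc 1 m, ⟪x j, x n⟫ * (Real.pi *
        ((if j ≤ n then a (n - j) else 0) + (if n ≤ j then a (j - n) else 0))) := by
    simp only [Finset.mul_sum]
    rw [intervalIntegral.integral_finsetSum
      (fun i _ => Continuous.intervalIntegrable (by fun_prop) _ _)]
    refine Finset.sum_congr rfl fun n hn => ?_
    rw [intervalIntegral.integral_finsetSum
      (fun i _ => Continuous.intervalIntegrable (by fun_prop) _ _)]
    refine Finset.sum_congr rfl fun j hj => ?_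
    rw [← key n hn j hj, ← key j hj n hn, ← Finset.sum_add_distrib, Finset.mul_sum, Finset.mul_sum]
    have : ∀ θ : ℝ, (∑ k ∈ Finset.range M, a k * Real.cos (k * θ)) * (⟪x j, x n⟫ *
          Real.cos (((n : ℤ) - j : ℤ) * θ)) = ∑ k ∈ Finset.range M, (⟪x j, x n⟫ * a k) *
          (Real.cos ((k : ℤ) * θ) * Real.cos (((n : ℤ) - j : ℤ) * θ)) := fun θ => by
      rw [Finset.sum_mul]
      refine Finset.sum_congr rfl fun k _ => ?_
      push_cast
      ring
    simp_rw [this]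
    rw [intervalIntegral.integral_finsetSum
      (fun i _ => Continuous.intervalIntegrable (by fun_prop) _ _)]
    refine Finset.sum_congr rfl fun k _ => ?_
    rw [intervalIntegral.integral_const_mul, integral_cos_mul_cos_int, neg_sub]
    ring
  rw [h1]
  have h2 : ∑ n ∈ Finset.Icc 1 m, ∑ j ∈ Finset.Icc 1 m,
      (if n ≤ j then a (j - n) else 0) * ⟪x j, x n⟫ =
      ∑ n ∈ Finset.Icc 1 m, ∑ j ∈ Finset.Icc 1 m,
      (if j ≤ n then a (n - j) else 0) * ⟪x j, x n⟫ := by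
    rw [Finset.sum_comm]
    simp only [real_inner_comm]
  have h3 : ∑ n ∈ Finset.Icc 1 m, ∑ j ∈ Finset.Icc 1 m,
      (if j ≤ n then a (n - j) else 0) * ⟪x j, x n⟫ =
      ∑ n ∈ Finset.Icc 1 m, ∑ j ∈ Finset.Icc 1 n, a (n - j) * ⟪x j, x n⟫ := by
    refine Finset.sum_congr rfl fun n hn => ?_
    rw [Finset.mem_Icc] at hn
    simp only [ite_mul, zero_mul]
    rw [← Finset.sum_filter]
    refine Finset.sum_congr ?_ fun _ _ => rfl
    ext j
    simp
    omega
  rw [← h3, two_mul, add_mul]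
  nth_rw 2 [← h2]
  simp only [Finset.mul_sum, ← Finset.sum_add_distrib]
  refine Finset.sum_congr rfl fun n _ => Finset.sum_congr rfl fun j _ => ?_
  ring

/-- The nonnegative series is integrated against a nonnegative trigonometric polynomial. Its partial
sums need not be nonnegative, but they are at least minus the absolute tail, which tends to zero. -/
theorem sum_conv_inner_nonneg_of_cos_series (a : ℕ → ℝ)
    (ha : ∀ θ : ℝ, ∃ S : ℝ, 0 ≤ S ∧ HasSum (fun k => a k * Real.cos (k * θ)) S)
    (m : ℕ) (x : ℕ → E) :
    0 ≤ ∑ n ∈ Finset.Icc 1 m, ∑ j ∈ Finset.Icc 1 n, a (n - j) * ⟪x j, x n⟫ := by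
  -- Real summability is absolute, so `θ = 0` suffices.
  have hsum : Summable (fun k => |a k|) := by
    obtain ⟨S, _, hS⟩ := ha 0
    simpa using hS.summable.abs
  set X : ℝ → ℝ := fun θ => ∑ n ∈ Finset.Icc 1 m, ∑ j ∈ Finset.Icc 1 m, ⟪x j, x n⟫ *
          Real.cos (((n : ℤ) - j : ℤ) * θ) with hX
  have hXc : Continuous X := by fun_prop
  have hX0 : ∀ θ, 0 ≤ X θ := sum_inner_mul_cos_nonneg _ x
  set tail : ℕ → ℝ := fun M => ∑' k, |a (k + M)| with htail
  have hlow : ∀ M θ, -tail M ≤ ∑ k ∈ Finset.range M, a k * Real.cos (k * θ) := by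
    intro M θ
    obtain ⟨S, hS0, hS⟩ := ha θ
    have h1 := hS.summable.sum_add_tsum_nat_add M
    rw [hS.tsum_eq] at h1
    have hs1 : Summable fun k => |a (k + M)| := (summable_nat_add_iff M).2 hsum
    have h2 : ∑' k, a (k + M) * Real.cos ((k + M : ℕ) * θ) ≤ tail M := by
      refine Summable.tsum_le_tsum (fun k => ?_) ((summable_nat_add_iff M).2 hS.summable) hs1
      refine (le_abs_self _).trans ?_
      rw [abs_mul]
      exact mul_le_of_le_one_right (abs_nonneg _) (Real.abs_cos_le_one _)
    linarith
  have hpi := Real.pi_pos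
  set R := ∑ n ∈ Finset.Icc 1 m, ∑ j ∈ Finset.Icc 1 n, a (n - j) * ⟪x j, x n⟫ with hR
  have hM : ∀ M, m < M → -tail M * (∫ θ in (0 : ℝ)..(2 * Real.pi), X θ) ≤ 2 * Real.pi * R := by
    intro M hmM
    rw [← sum_trig_conv_eq_integral a m M hmM x, ← intervalIntegral.integral_const_mul]
    refine intervalIntegral.integral_mono_on (by positivity)
      (Continuous.intervalIntegrable (by fun_prop) _ _)
      (Continuous.intervalIntegrable (by fun_prop) _ _) fun θ _ => ?_
    exact mul_le_mul_of_nonneg_right (hlow M θ) (hX0 θ)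
  have hlim : Tendsto (fun M => -tail M * (∫ θ in (0 : ℝ)..(2 * Real.pi), X θ)) atTop (𝓝 0) := by
    have := (tendsto_sum_nat_add fun k => |a k|).neg.mul_const (∫ θ in (0 : ℝ)..(2 * Real.pi), X θ)
    simpa using this
  have h0 : 0 ≤ 2 * Real.pi * R :=
    le_of_tendsto hlim ((eventually_gt_atTop m).mono fun M h => hM M h)
  exact nonneg_of_mul_nonneg_right h0 (by positivity)

/-- The weights `χ_n^(μ)`, `0 ≤ μ ≤ 1`, form a sequence of positive type. -/
theorem sum_cqWeight_conv_inner_nonneg {μ : ℝ} (h0 : 0 ≤ μ) (h1 : μ ≤ 1) (m : ℕ) (x : ℕ → E) :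
    0 ≤ ∑ n ∈ Finset.Icc 1 m, ∑ j ∈ Finset.Icc 1 n, cqWeight μ (n - j) * ⟪x j, x n⟫ := by
  -- The cosine series is only available inside the unit disc, hence the damping factor `r ^ k`; the
  -- finite sum is continuous in `r`, so `r → 1` recovers the claim.
  set P : ℝ → ℝ := fun r => ∑ n ∈ Finset.Icc 1 m, ∑ j ∈ Finset.Icc 1 n,
    cqWeight μ (n - j) * r ^ (n - j) * ⟪x j, x n⟫ with hP
  have hc : Continuous P := by fun_prop
  have hlim : Tendsto P (𝓝[<] 1) (𝓝 (P 1)) := hc.continuousAt.tendsto.mono_left nhdsWithin_le_nhds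
  have hP1 : P 1 = ∑ n ∈ Finset.Icc 1 m, ∑ j ∈ Finset.Icc 1 n, cqWeight μ (n - j) * ⟪x j, x n⟫ := by
    simp [hP]
  rw [← hP1]
  refine ge_of_tendsto hlim ?_
  filter_upwards [Ioo_mem_nhdsLT (show (0 : ℝ) < 1 by norm_num)] with r hr
  exact sum_conv_inner_nonneg_of_cos_series (fun k => cqWeight μ k * r ^ k)
    (fun θ => tsum_cqWeight_cos_nonneg h0 h1 hr.1.le hr.2 θ) m x

end PositiveType

/-! ### Green's formula for the Dirichlet Laplacian -/

section Green

variable {d : ℕ} {Ω : Set (EuclideanSpace ℝ (Fin d))}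

theorem IsTestFunction.memLp {φ : EuclideanSpace ℝ (Fin d) → ℝ} (h : IsTestFunction Ω φ) :
    MemLp φ 2 (volume.restrict Ω) :=
  h.smooth.continuous.memLp_of_hasCompactSupport h.compact

theorem IsTestFunction.memLp_partialDeriv {φ : EuclideanSpace ℝ (Fin d) → ℝ}
    (h : IsTestFunction Ω φ) (i : Fin d) : MemLp (partialDeriv i φ) 2 (volume.restrict Ω) := by
  have hc : Continuous (partialDeriv i φ) :=
    (h.smooth.continuous_fderiv (by simp)).clm_apply continuous_const
  refine hc.memLp_of_hasCompactSupport ?_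
  exact h.compact.fderiv_apply (𝕜 := ℝ) (EuclideanSpace.single i 1)

theorem inner_toLp_eq_integral (v : L2 Ω) {φ : EuclideanSpace ℝ (Fin d) → ℝ}
    (h : MemLp φ 2 (volume.restrict Ω)) : ⟪v, h.toLp φ⟫ = ∫ x in Ω, v x * φ x := by
  rw [L2.inner_def]
  refine integral_congr_ae ?_
  filter_upwards [h.coeFn_toLp] with x hx
  rw [hx]
  simp [mul_comm]

theorem norm_sub_toLp_lt (v : L2 Ω) {φ : EuclideanSpace ℝ (Fin d) → ℝ}
    (h : MemLp φ 2 (volume.restrict Ω)) {ε : ℝ} (hε : 0 < ε)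
    (hlt : eLpNorm (fun x => v x - φ x) 2 (volume.restrict Ω) < ENNReal.ofReal ε) :
    ‖v - h.toLp φ‖ < ε := by
  rw [Lp.norm_def, ← ENNReal.toReal_ofReal hε.le]
  refine ENNReal.toReal_strict_mono ENNReal.ofReal_ne_top (lt_of_le_of_lt (le_of_eq ?_) hlt)
  refine eLpNorm_congr_ae ?_
  filter_upwards [Lp.coeFn_sub v (h.toLp φ), h.coeFn_toLp] with x h1 h2
  rw [h1, Pi.sub_apply, h2]

/-- The weak divergence identity for `G` is tested with functions that approximate `w` in `H¹`. Only
`w` has to lie in `H¹₀`. -/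
theorem inner_eq_neg_sum_inner_gradient {v w : L2 Ω} {G H : Fin d → L2 Ω}
    (hG : ∀ φ, IsTestFunction Ω φ →
      ∑ i : Fin d, ∫ x in Ω, G i x * partialDeriv i φ x = -∫ x in Ω, v x * φ x)
    (hH : MemH10WithGradient Ω w H) : ⟪v, w⟫ = -∑ i, ⟪G i, H i⟫ := by
  have key : ∀ ε : ℝ, 0 < ε → |⟪v, w⟫ + ∑ i, ⟪G i, H i⟫| ≤ (‖v‖ + ∑ i, ‖G i‖) * ε := by
    intro ε hε
    obtain ⟨φ, hφ, h0, h1⟩ := hH.2 ε hε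
    have e1 : ⟪v, hφ.memLp.toLp φ⟫ + ∑ i, ⟪G i, (hφ.memLp_partialDeriv i).toLp _⟫ = 0 := by
      simp_rw [inner_toLp_eq_integral]
      rw [hG φ hφ]
      ring
    have e2 : ⟪v, w⟫ + ∑ i, ⟪G i, H i⟫ = ⟪v, w - hφ.memLp.toLp φ⟫ +
        ∑ i, ⟪G i, H i - (hφ.memLp_partialDeriv i).toLp _⟫ := by
      simp_rw [inner_sub_right, Finset.sum_sub_distrib]
      linarith
    rw [e2, add_mul, Finset.sum_mul]
    refine (abs_add_le _ _).trans (add_le_add ?_ ((Finset.abs_sum_le_sum_abs _ _).trans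
      (Finset.sum_le_sum fun i _ => ?_)))
    · refine (abs_real_inner_le_norm _ _).trans ?_
      exact mul_le_mul_of_nonneg_left (norm_sub_toLp_lt w hφ.memLp hε h0).le (norm_nonneg _)
    · refine (abs_real_inner_le_norm _ _).trans ?_
      exact mul_le_mul_of_nonneg_left
        (norm_sub_toLp_lt (H i) (hφ.memLp_partialDeriv i) hε (h1 i)).le (norm_nonneg _)
  have hlim : Tendsto (fun ε : ℝ => (‖v‖ + ∑ i, ‖G i‖) * ε) (𝓝[>] 0) (𝓝 0) := by
    have : Continuous fun ε : ℝ => (‖v‖ + ∑ i, ‖G i‖) * ε := by fun_prop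
    have h := this.tendsto 0
    rw [mul_zero] at h
    exact h.mono_left nhdsWithin_le_nhds
  have h0 : |⟪v, w⟫ + ∑ i, ⟪G i, H i⟫| ≤ 0 :=
    ge_of_tendsto hlim (eventually_mem_nhdsWithin.mono fun ε hε => key ε hε)
  have := abs_nonpos_iff.1 h0
  linarith

theorem IsDirichletLaplacian.eq_zero (hΩ : IsOpen Ω) {v : L2 Ω} (h : IsDirichletLaplacian Ω 0 v) :
    v = 0 := by
  obtain ⟨G, hG, hv⟩ := h
  have hG0 : ∀ i, G i = 0 := fun i => L2_ext_of_test hΩ fun φ hφ => by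
    have h0 := hG.1 φ hφ i
    have h1 : ∫ x in Ω, (0 : L2 Ω) x * partialDeriv i φ x = 0 := by
      rw [← inner_toLp_eq_integral _ (hφ.memLp_partialDeriv i), inner_zero_left]
    rw [← inner_toLp_eq_integral 0 hφ.memLp, inner_zero_left]
    linarith
  refine L2_ext_of_test hΩ fun φ hφ => ?_
  have h0 := hv φ hφ
  simp_rw [← inner_toLp_eq_integral _ (hφ.memLp_partialDeriv _), hG0, inner_zero_left] at h0
  rw [← inner_toLp_eq_integral 0 hφ.memLp, inner_zero_left]
  simp at h0
  exact h0

end Green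

/-! ### Stability of the time discretization in a Hilbert space -/

section Stability

variable {E : Type*} [NormedAddCommGroup E] [InnerProductSpace ℝ E]

/-- `τ` times the difference operator of the scheme, for `U⁰ = 0`. -/
noncomputable def startedBdf2 (U : ℕ → E) (n : ℕ) : E :=
  if n = 1 then U 1 else (3 / 2 : ℝ) • U n - (2 : ℝ) • U (n - 1) + (1 / 2 : ℝ) • U (n - 2)

/-- The weights obtained from `w` by summation by parts. -/
def abelWeight (w : ℕ → ℝ) (n : ℕ) : ℝ := if n = 0 then w 0 else w n - w (n - 1)

/-- Moves the difference from `U`, about which nothing is known, to `w`, whose differences are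
`O(τ²)`. -/
theorem sum_smul_sub_eq_sum_abelWeight (w : ℕ → ℝ) {U : ℕ → E} (h0 : U 0 = 0) (n : ℕ) :
    ∑ k ∈ Finset.Icc 1 n, w (n - k) • (U k - U (k - 1)) =
      ∑ k ∈ Finset.Icc 1 n, abelWeight w (n - k) • U k := by
  rcases n with _ | p
  · simp
  have hr : ∀ g : ℕ → E, ∑ k ∈ Finset.Icc 1 (p + 1), g k = ∑ k ∈ Finset.range (p + 1), g (k + 1) := by
    intro g
    rw [Finset.range_eq_Ico, Finset.sum_Ico_add' g 0 (p + 1) 1]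
    rfl
  rw [hr, hr, Finset.sum_range_succ (fun k => abelWeight w (p + 1 - (k + 1)) • U (k + 1))]
  simp only [Nat.add_sub_add_right, Nat.add_sub_cancel, smul_sub, Finset.sum_sub_distrib]
  rw [Finset.sum_range_succ, Finset.sum_range_succ' (fun k => w (p - k) • U k), h0, smul_zero,
    add_zero, Nat.sub_self, add_sub_right_comm, ← Finset.sum_sub_distrib]
  congr 1
  refine Finset.sum_congr rfl fun k hk => ?_
  rw [Finset.mem_range] at hk
  rw [abelWeight, if_neg (by omega), ← sub_smul, Nat.sub_sub]

/-- G-stability of BDF2: the gap between the two sides is `‖a - 2b + c‖² / 4`. -/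
theorem inner_bdf2_ge (a b c : E) :
    (‖a‖ ^ 2 + ‖(2 : ℝ) • a - b‖ ^ 2) / 4 - (‖b‖ ^ 2 + ‖(2 : ℝ) • b - c‖ ^ 2) / 4 ≤
      ⟪(3 / 2 : ℝ) • a - (2 : ℝ) • b + (1 / 2 : ℝ) • c, a⟫ := by
  have h : 0 ≤ ‖a - (2 : ℝ) • b + c‖ ^ 2 := by positivity
  simp only [← real_inner_self_eq_norm_sq, inner_add_left, inner_add_right, inner_sub_left,
    inner_sub_right, real_inner_smul_left, real_inner_smul_right] at h ⊢
  rw [real_inner_comm a b, real_inner_comm a c, real_inner_comm b c] at *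
  linarith

/-- The G-norms telescope. At `n = 1` the difference is just `U 1`, and `(1 + 4)/4 - 1/4 = 1` gives
equality. -/
theorem sum_inner_startedBdf2_ge {U : ℕ → E} (h0 : U 0 = 0) (m : ℕ) (hm : 1 ≤ m) :
    (‖U m‖ ^ 2 + ‖(2 : ℝ) • U m - U (m - 1)‖ ^ 2) / 4 - ‖U 1‖ ^ 2 / 4 ≤
      ∑ n ∈ Finset.Icc 1 m, ⟪startedBdf2 U n, U n⟫ := by
  induction m, hm using Nat.le_induction with
  | base =>
    simp [startedBdf2, h0, norm_smul]
    linarith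
  | succ m hm ih =>
    rw [Finset.sum_Icc_succ_top (by omega)]
    have h := inner_bdf2_ge (U (m + 1)) (U m) (U (m - 1))
    rw [startedBdf2, if_neg (by omega), Nat.add_sub_cancel, show m + 1 - 2 = m - 1 by omega]
    linarith

theorem le_mul_pow_of_le_add_sum {M : ℕ → ℝ} {A k : ℝ} (hk : 0 ≤ k) {N : ℕ}
    (h : ∀ m ≤ N, M m ≤ A + k * ∑ n ∈ Finset.range m, M n) :
    ∀ m ≤ N, M m ≤ A * (1 + k) ^ m := by
  intro m
  induction m using Nat.strong_induction_on with
  | _ m ih =>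
    intro hm
    refine (h m hm).trans ?_
    have h1 : ∑ n ∈ Finset.range m, M n ≤ ∑ n ∈ Finset.range m, A * (1 + k) ^ n :=
      Finset.sum_le_sum fun n hn => by
        rw [Finset.mem_range] at hn
        exact ih n hn (by omega)
    have h2 : ∀ p : ℕ, A + k * ∑ n ∈ Finset.range p, A * (1 + k) ^ n = A * (1 + k) ^ p := by
      intro p
      induction p with
      | zero => simp
      | succ p ihp =>
        rw [Finset.sum_range_succ, mul_add, ← add_assoc, ihp]
        ring
    rw [← h2 m]
    gcongr

/-- A discrete Gronwall inequality for sequences bounded through their squares. -/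
theorem le_of_sq_le_sum {y b : ℕ → ℝ} {K : ℝ} {N : ℕ} (hK : 0 ≤ K) (hK8 : 8 * K ≤ 1)
    (hy : ∀ n, 0 ≤ y n) (hb : ∀ n, 0 ≤ b n) (hy0 : y 0 = 0)
    (h : ∀ m, 1 ≤ m → m ≤ N → y m ^ 2 ≤ y 1 ^ 2 +
      4 * ∑ n ∈ Finset.Icc 1 m, (b n + K * partialSups y n) * y n) :
    ∀ m, 1 ≤ m → m ≤ N →
      y m ≤ (2 * y 1 + 8 * ∑ n ∈ Finset.Icc 1 m, b n) * (1 + 8 * K) ^ m := by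
  set M : ℕ → ℝ := fun n => partialSups y n with hM
  have hMmono : Monotone M := (partialSups y).monotone
  have hyM : ∀ k n, k ≤ n → y k ≤ M n := fun k n hkn => le_partialSups_of_le y hkn
  have hM0 : ∀ n, 0 ≤ M n := fun n => (hy n).trans (hyM n n le_rfl)
  have hex : ∀ n, ∃ k ≤ n, M n = y k := by
    intro n
    induction n with
    | zero => exact ⟨0, le_rfl, by simp [hM]⟩
    | succ n ih =>
      obtain ⟨k, hk, hMk⟩ := ih
      have hs : M (n + 1) = max (M n) (y (n + 1)) := partialSups_add_one y n
      rcases max_choice (M n) (y (n + 1)) with h' | h'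
      · exact ⟨k, by omega, by rw [hs, h', hMk]⟩
      · exact ⟨n + 1, le_rfl, by rw [hs, h']⟩
  intro m hm hmN
  set B := ∑ n ∈ Finset.Icc 1 m, b n with hB
  have hB0 : 0 ≤ B := Finset.sum_nonneg fun n _ => hb n
  have step : ∀ p ≤ m, M p ≤ (2 * y 1 + 8 * B) + (8 * K) * ∑ n ∈ Finset.range p, M n := by
    intro p hp
    have hS0 : 0 ≤ ∑ n ∈ Finset.range p, M n := Finset.sum_nonneg fun n _ => hM0 n
    have hA0 : 0 ≤ (2 * y 1 + 8 * B) + (8 * K) * ∑ n ∈ Finset.range p, M n := by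
      have := hy 1
      positivity
    rcases (hM0 p).eq_or_lt with h0 | hpos
    · rw [← h0]; exact hA0
    -- The running maximum is attained at some `q ≤ p`. The hypothesis at `q` is then an inequality
    -- for `M p ^ 2` in which one factor `M p` cancels.
    obtain ⟨q, hqp, hq⟩ := hex p
    have hq1 : 1 ≤ q := by
      by_contra hq0
      have : q = 0 := by omega
      rw [this, hy0] at hq
      linarith
    have h1 := h q hq1 (by omega)
    rw [← hq] at h1
    have hy1 : y 1 ≤ M p := hyM 1 p (by omega)
    have h2 : ∑ n ∈ Finset.Icc 1 q, (b n + K * partialSups y n) * y n ≤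
        (B + K * (∑ n ∈ Finset.range p, M n + M p)) * M p := by
      have h3 : ∑ n ∈ Finset.Icc 1 q, (b n + K * partialSups y n) * y n ≤
          ∑ n ∈ Finset.Icc 1 q, (b n + K * M n) * M p := by
        refine Finset.sum_le_sum fun n hn => ?_
        rw [Finset.mem_Icc] at hn
        exact mul_le_mul_of_nonneg_left (hyM n p (by omega))
          (add_nonneg (hb n) (mul_nonneg hK (hM0 n)))
      refine h3.trans ?_
      rw [← Finset.sum_mul, Finset.sum_add_distrib, ← Finset.mul_sum]
      refine mul_le_mul_of_nonneg_right (add_le_add ?_ (mul_le_mul_of_nonneg_left ?_ hK)) (hM0 p)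
      · exact Finset.sum_le_sum_of_subset_of_nonneg (Finset.Icc_subset_Icc le_rfl (by omega))
          fun n _ _ => hb n
      · rw [← Finset.sum_range_succ]
        refine Finset.sum_le_sum_of_subset_of_nonneg ?_ fun n _ _ => hM0 n
        intro n hn
        rw [Finset.mem_Icc] at hn
        rw [Finset.mem_range]
        omega
    have h4 : M p * M p ≤ (y 1 + 4 * (B + K * (∑ n ∈ Finset.range p, M n + M p))) * M p := by
      nlinarith [mul_le_mul_of_nonneg_left hy1 (hy 1)]
    -- The term `4 K M p ≤ M p / 2` is absorbed on the left, which doubles the other constants.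
    have h5 := le_of_mul_le_mul_right h4 hpos
    nlinarith
  exact (hyM m m le_rfl).trans (le_mul_pow_of_le_add_sum (by positivity) step m le_rfl)

/-- Fewer than `N` weights are at most `C τ²` each, together at most `C T τ`; the remaining one is
at most `C τ`. -/
theorem norm_sum_abelWeight_smul_le {w : ℕ → ℝ} {C τ T : ℝ} {N : ℕ} (hτ : 0 ≤ τ)
    (hN : N * τ ≤ T) (hC : 0 ≤ C) (hw0 : |w 0| ≤ C * τ)
    (hw : ∀ k, k + 2 ≤ N → |w (k + 1) - w k| ≤ C * τ ^ 2) (U : ℕ → E) {n : ℕ} (hn : 1 ≤ n)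
    (hnN : n ≤ N) :
    ‖∑ k ∈ Finset.Icc 1 n, abelWeight w (n - k) • U k‖ ≤
      C * (1 + T) * τ * partialSups (fun k => ‖U k‖) n := by
  set M := partialSups (fun k => ‖U k‖) n with hM
  have hUM : ∀ k ≤ n, ‖U k‖ ≤ M := fun k hk => le_partialSups_of_le (fun k => ‖U k‖) hk
  have hM0 : 0 ≤ M := (norm_nonneg _).trans (hUM n le_rfl)
  obtain ⟨p, rfl⟩ : ∃ p, n = p + 1 := ⟨n - 1, by omega⟩
  rw [Finset.sum_Icc_succ_top (by omega), Nat.sub_self]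
  have h1 : ‖abelWeight w 0 • U (p + 1)‖ ≤ C * τ * M := by
    rw [norm_smul, abelWeight, if_pos rfl]
    exact mul_le_mul hw0 (hUM _ le_rfl) (norm_nonneg _) (by positivity)
  have h2 : ‖∑ k ∈ Finset.Icc 1 p, abelWeight w (p + 1 - k) • U k‖ ≤ p * (C * τ ^ 2 * M) := by
    refine (norm_sum_le_of_le (f := fun k => abelWeight w (p + 1 - k) • U k)
      (n := fun _ => C * τ ^ 2 * M) _ fun k hk => ?_).trans (by simp)
    rw [Finset.mem_Icc] at hk
    rw [norm_smul, abelWeight, if_neg (by omega)]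
    refine mul_le_mul ?_ (hUM _ (by omega)) (norm_nonneg _) (by positivity)
    have := hw (p + 1 - k - 1) (by omega)
    rwa [show p + 1 - k - 1 + 1 = p + 1 - k by omega] at this
  have h3 : (p : ℝ) * τ ≤ T := by
    refine le_trans (mul_le_mul_of_nonneg_right ?_ hτ) hN
    exact_mod_cast (by omega : p ≤ N)
  refine (norm_add_le _ _).trans ((add_le_add h2 h1).trans ?_)
  have : (p : ℝ) * τ * (C * τ * M) ≤ T * (C * τ * M) :=
    mul_le_mul_of_nonneg_right h3 (by positivity)
  nlinarith

theorem stability_of_small_step {w χ : ℕ → ℝ} {C τ T c : ℝ} {N : ℕ} (hτ : 0 ≤ τ)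
    (hN : N * τ ≤ T) (hC : 0 ≤ C) (hw0 : |w 0| ≤ C * τ)
    (hw : ∀ k, k + 2 ≤ N → |w (k + 1) - w k| ≤ C * τ ^ 2) (hsmall : 8 * (C * (1 + T) * τ) ≤ 1)
    (hc : 0 ≤ c) {U AU F : ℕ → E} (h0 : U 0 = 0)
    (hpos : ∀ m ≤ N, ∑ n ∈ Finset.Icc 1 m, ⟪∑ j ∈ Finset.Icc 1 n, χ (n - j) • AU j, U n⟫ ≤ 0)
    (heq : ∀ n, 1 ≤ n → n ≤ N → startedBdf2 U n + ∑ k ∈ Finset.Icc 1 n, abelWeight w (n - k) • U k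
      - c • ∑ j ∈ Finset.Icc 1 n, χ (n - j) • AU j = F n) :
    ∀ m, 1 ≤ m → m ≤ N →
      ‖U m‖ ≤ 12 * Real.exp (8 * (C * (1 + T) * T)) * ∑ n ∈ Finset.Icc 1 m, ‖F n‖ := by
  have hT : 0 ≤ T := le_trans (by positivity) hN
  set K := C * (1 + T) * τ with hK
  have hK0 : 0 ≤ K := by positivity
  have henergy : ∀ m, 1 ≤ m → m ≤ N → ∑ n ∈ Finset.Icc 1 m, ⟪startedBdf2 U n, U n⟫ ≤
      ∑ n ∈ Finset.Icc 1 m, (‖F n‖ + K * partialSups (fun k => ‖U k‖) n) * ‖U n‖ := by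
    intro m hm hmN
    have h1 : ∀ n ∈ Finset.Icc 1 m, ⟪startedBdf2 U n, U n⟫ ≤
        (‖F n‖ + K * partialSups (fun k => ‖U k‖) n) * ‖U n‖ +
          c * ⟪∑ j ∈ Finset.Icc 1 n, χ (n - j) • AU j, U n⟫ := by
      intro n hn
      rw [Finset.mem_Icc] at hn
      have e : startedBdf2 U n = F n - ∑ k ∈ Finset.Icc 1 n, abelWeight w (n - k) • U k
          + c • ∑ j ∈ Finset.Icc 1 n, χ (n - j) • AU j := by
        rw [← heq n hn.1 (by omega)]
        abel
      rw [e, inner_add_left, real_inner_smul_left]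
      refine add_le_add ((real_inner_le_norm _ _).trans ?_) le_rfl
      refine mul_le_mul_of_nonneg_right ((norm_sub_le _ _).trans ?_) (norm_nonneg _)
      exact add_le_add le_rfl
        (norm_sum_abelWeight_smul_le hτ hN hC hw0 hw U hn.1 (by omega))
    refine (Finset.sum_le_sum h1).trans ?_
    rw [Finset.sum_add_distrib, ← Finset.mul_sum]
    have := mul_nonpos_of_nonneg_of_nonpos hc (hpos m hmN)
    linarith
  intro m hm hmN
  have hU1 : ‖U 1‖ ≤ 2 * ‖F 1‖ := by
    have h1 := henergy 1 le_rfl (by omega)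
    simp only [Finset.Icc_self, Finset.sum_singleton, startedBdf2, if_true,
      real_inner_self_eq_norm_sq] at h1
    have h2 : partialSups (fun k => ‖U k‖) 1 = ‖U 1‖ := by
      have := partialSups_add_one (fun k => ‖U k‖) 0
      simpa [h0] using this
    rw [h2] at h1
    rcases (norm_nonneg (U 1)).eq_or_lt with h | h
    · rw [← h]; positivity
    · have h3 : ‖U 1‖ * ‖U 1‖ ≤ (‖F 1‖ + K * ‖U 1‖) * ‖U 1‖ := by linarith
      have h4 := le_of_mul_le_mul_right h3 h
      nlinarith
  have hg := le_of_sq_le_sum (y := fun n => ‖U n‖) (b := fun n => ‖F n‖) (K := K) (N := N) hK0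
    hsmall (fun n => norm_nonneg _) (fun n => norm_nonneg _) (by simp [h0]) (by
      intro p hp hpN
      have h1 := sum_inner_startedBdf2_ge h0 p hp
      have h2 := henergy p hp hpN
      have h3 : 0 ≤ ‖(2 : ℝ) • U p - U (p - 1)‖ ^ 2 := by positivity
      linarith) m hm hmN
  refine hg.trans ?_
  have hF1 : ‖F 1‖ ≤ ∑ n ∈ Finset.Icc 1 m, ‖F n‖ :=
    Finset.single_le_sum (f := fun n => ‖F n‖) (fun n _ => norm_nonneg _)
      (Finset.mem_Icc.2 ⟨le_rfl, hm⟩)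
  have hS0 : 0 ≤ ∑ n ∈ Finset.Icc 1 m, ‖F n‖ := Finset.sum_nonneg fun n _ => norm_nonneg _
  have hexp : (1 + 8 * K) ^ m ≤ Real.exp (8 * (C * (1 + T) * T)) := by
    have h1 : (1 + 8 * K) ^ m ≤ Real.exp (8 * K) ^ m :=
      pow_le_pow_left₀ (by positivity) (by linarith [Real.add_one_le_exp (8 * K)]) m
    refine h1.trans ?_
    rw [← Real.exp_nat_mul]
    refine Real.exp_le_exp.2 ?_
    have h2 : (m : ℝ) * τ ≤ T := by
      refine le_trans (mul_le_mul_of_nonneg_right ?_ hτ) hN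
      exact_mod_cast hmN
    calc (m : ℝ) * (8 * K) = 8 * (C * (1 + T)) * (m * τ) := by rw [hK]; ring
      _ ≤ 8 * (C * (1 + T)) * T := by gcongr
      _ = _ := by ring
  -- From `‖U 1‖ ≤ 2 ‖F 1‖`: the constant is `2 · 2 + 8 = 12`.
  have h12 : 2 * ‖U 1‖ + 8 * ∑ n ∈ Finset.Icc 1 m, ‖F n‖ ≤ 12 * ∑ n ∈ Finset.Icc 1 m, ‖F n‖ := by
    linarith
  calc _ ≤ (12 * ∑ n ∈ Finset.Icc 1 m, ‖F n‖) * Real.exp (8 * (C * (1 + T) * T)) := by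
        exact mul_le_mul h12 hexp (by positivity) (by positivity)
    _ = _ := by ring

end Stability

/-! ### Stability for a fixed number of steps -/

section FixedStep

variable {E : Type*} [NormedAddCommGroup E] [InnerProductSpace ℝ E]

theorem norm_le_of_dissipative {a c : ℝ} (ha : 0 < a) (hc : 0 ≤ c) {W AW R : E}
    (hW : ⟪AW, W⟫ ≤ 0) (h : a • W - c • AW = R) : ‖W‖ ≤ a⁻¹ * ‖R‖ := by
  have h1 : a * ‖W‖ ^ 2 ≤ ‖R‖ * ‖W‖ := by
    refine le_trans ?_ (real_inner_le_norm R W)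
    rw [← h, inner_sub_left, real_inner_smul_left, real_inner_smul_left,
      real_inner_self_eq_norm_sq]
    linarith [mul_nonpos_of_nonneg_of_nonpos hc hW]
  rw [inv_mul_eq_div, le_div_iff₀ ha]
  rcases (norm_nonneg W).eq_or_lt with h0 | h0
  · rw [← h0]; simp
  · refine le_of_mul_le_mul_right ?_ h0
    linarith

/-- The combination `W = ∑ (χ_{n-k}/χ_0) U k` absorbs the whole convolution into a single `A W`.
Dissipativity bounds `W` with no bound on `A`, and the earlier values enter only through `U k`, not
`A U k`. -/
theorem norm_le_of_convolution_step {b : ℕ → ℕ → ℝ} {χ : ℕ → ℝ} (hχ : 0 < χ 0) {n : ℕ}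
    (hn : 1 ≤ n) (hb : 0 < b n n) {c : ℝ} (hc : 0 ≤ c) {U AU : ℕ → E} {R : E}
    (hdis : ∀ r : ℕ → ℝ,
      ⟪∑ k ∈ Finset.Icc 1 n, r k • AU k, ∑ k ∈ Finset.Icc 1 n, r k • U k⟫ ≤ 0)
    (heq : ∑ k ∈ Finset.Icc 1 n, b n k • U k - c • ∑ k ∈ Finset.Icc 1 n, χ (n - k) • AU k = R) :
    ‖U n‖ ≤ (b n n)⁻¹ * ‖R‖ + ∑ k ∈ Finset.Ico 1 n, ((b n n)⁻¹ *
      |b n n * (χ (n - k) / χ 0) - b n k| + |χ (n - k) / χ 0|) * ‖U k‖ := by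
  set r : ℕ → ℝ := fun k => χ (n - k) / χ 0 with hr
  have hrn : r n = 1 := by simp [hr, hχ.ne']
  have hsplit : ∀ g : ℕ → E, ∑ k ∈ Finset.Icc 1 n, g k = ∑ k ∈ Finset.Ico 1 n, g k + g n := by
    intro g
    rw [← Finset.sum_Ico_succ_top hn]
    rfl
  set W := ∑ k ∈ Finset.Icc 1 n, r k • U k with hW
  have hAW : c • ∑ k ∈ Finset.Icc 1 n, χ (n - k) • AU k =
      (c * χ 0) • ∑ k ∈ Finset.Icc 1 n, r k • AU k := by
    rw [mul_smul]
    congr 1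
    rw [Finset.smul_sum]
    refine Finset.sum_congr rfl fun k _ => ?_
    rw [smul_smul, hr, mul_div_cancel₀ _ hχ.ne']
  have hWeq : b n n • W - (c * χ 0) • ∑ k ∈ Finset.Icc 1 n, r k • AU k =
      R + ∑ k ∈ Finset.Ico 1 n, (b n n * r k - b n k) • U k := by
    rw [← heq, ← hAW, hW, hsplit (fun k => r k • U k), hsplit (fun k => b n k • U k), hrn]
    simp only [sub_smul, Finset.sum_sub_distrib, mul_smul, smul_add, Finset.smul_sum, one_smul]
    abel
  have h1 := norm_le_of_dissipative hb (mul_nonneg hc hχ.le) (hdis r) hWeq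
  have h2 : U n = W - ∑ k ∈ Finset.Ico 1 n, r k • U k := by
    rw [hW, hsplit, hrn, one_smul]
    abel
  have h3 : ‖∑ k ∈ Finset.Ico 1 n, (b n n * r k - b n k) • U k‖ ≤
      ∑ k ∈ Finset.Ico 1 n, |b n n * r k - b n k| * ‖U k‖ :=
    norm_sum_le_of_le _ fun k _ => by rw [norm_smul, Real.norm_eq_abs]
  have h4 : ‖∑ k ∈ Finset.Ico 1 n, r k • U k‖ ≤ ∑ k ∈ Finset.Ico 1 n, |r k| * ‖U k‖ :=
    norm_sum_le_of_le _ fun k _ => by rw [norm_smul, Real.norm_eq_abs]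
  have hb' : 0 ≤ (b n n)⁻¹ := by positivity
  calc ‖U n‖ ≤ ‖W‖ + ‖∑ k ∈ Finset.Ico 1 n, r k • U k‖ := by
        conv_lhs => rw [h2]
        exact norm_sub_le _ _
    _ ≤ (b n n)⁻¹ * (‖R‖ + ∑ k ∈ Finset.Ico 1 n, |b n n * r k - b n k| * ‖U k‖) +
        ∑ k ∈ Finset.Ico 1 n, |r k| * ‖U k‖ := by
        refine add_le_add (h1.trans (mul_le_mul_of_nonneg_left ?_ hb')) h4
        exact (norm_add_le _ _).trans (add_le_add le_rfl h3)
    _ = _ := by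
        rw [mul_add, Finset.mul_sum, add_assoc, ← Finset.sum_add_distrib]
        congr 1
        refine Finset.sum_congr rfl fun k _ => ?_
        ring

/-- For a fixed number of steps the scheme is stable, with a constant that is independent of the
dissipative operator. -/
theorem stability_of_fixed_length (E : Type*) [NormedAddCommGroup E] [InnerProductSpace ℝ E]
    (b : ℕ → ℕ → ℝ) {χ : ℕ → ℝ} (hχ : 0 < χ 0) (N : ℕ)
    (hb : ∀ n, 1 ≤ n → n ≤ N → 0 < b n n) :
    ∃ K : ℝ, 0 ≤ K ∧ ∀ (c : ℝ) (U AU F : ℕ → E), 0 ≤ c →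
      (∀ m ≤ N, ∀ r : ℕ → ℝ,
        ⟪∑ k ∈ Finset.Icc 1 m, r k • AU k, ∑ k ∈ Finset.Icc 1 m, r k • U k⟫ ≤ 0) →
      (∀ n, 1 ≤ n → n ≤ N → ∑ k ∈ Finset.Icc 1 n, b n k • U k -
        c • ∑ k ∈ Finset.Icc 1 n, χ (n - k) • AU k = F n) →
      ∀ m, 1 ≤ m → m ≤ N → ‖U m‖ ≤ K * ∑ n ∈ Finset.Icc 1 m, ‖F n‖ := by
  induction N with
  | zero => exact ⟨0, le_rfl, fun c U AU F _ _ _ m h1 h2 => by omega⟩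
  | succ N ih =>
    obtain ⟨K, hK, h⟩ := ih fun n h1 h2 => hb n h1 (by omega)
    have hbN := hb (N + 1) (by omega) le_rfl
    set g : ℕ → ℝ := fun k => (b (N + 1) (N + 1))⁻¹ *
      |b (N + 1) (N + 1) * (χ (N + 1 - k) / χ 0) - b (N + 1) k| + |χ (N + 1 - k) / χ 0| with hg
    have hg0 : ∀ k, 0 ≤ g k := fun k => by positivity
    -- The one-step bound with the constant `K` of the earlier steps inserted.
    set K' := (b (N + 1) (N + 1))⁻¹ + ∑ k ∈ Finset.Ico 1 (N + 1), g k * K with hK'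
    have hs0 : 0 ≤ ∑ k ∈ Finset.Ico 1 (N + 1), g k * K :=
      Finset.sum_nonneg fun k _ => mul_nonneg (hg0 k) hK
    have hK'0 : 0 ≤ K' := by positivity
    refine ⟨max K K', le_max_of_le_left hK, fun c U AU F hc hdis heq m hm hmN => ?_⟩
    have hF0 : ∀ p, 0 ≤ ∑ n ∈ Finset.Icc 1 p, ‖F n‖ :=
      fun p => Finset.sum_nonneg fun n _ => norm_nonneg _
    have hprev := h c U AU F hc (fun p hp => hdis p (by omega)) fun n h1 h2 => heq n h1 (by omega)
    rcases Nat.lt_or_ge N m with hlt | hle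
    · obtain rfl : m = N + 1 := by omega
      refine le_trans ?_ (mul_le_mul_of_nonneg_right (le_max_right _ _) (hF0 _))
      refine (norm_le_of_convolution_step hχ hm hbN hc (hdis _ le_rfl) (heq _ hm le_rfl)).trans ?_
      rw [hK', add_mul, Finset.sum_mul]
      refine add_le_add (mul_le_mul_of_nonneg_left ?_ (by positivity)) (Finset.sum_le_sum ?_)
      · exact Finset.single_le_sum (f := fun n => ‖F n‖) (fun n _ => norm_nonneg _)
          (Finset.mem_Icc.2 ⟨hm, le_rfl⟩)
      · intro k hk
        rw [Finset.mem_Ico] at hk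
        rw [mul_assoc]
        refine mul_le_mul_of_nonneg_left ((hprev k hk.1 (by omega)).trans ?_) (hg0 k)
        refine mul_le_mul_of_nonneg_left ?_ hK
        exact Finset.sum_le_sum_of_subset_of_nonneg (Finset.Icc_subset_Icc le_rfl (by omega))
          fun n _ _ => norm_nonneg _
    · exact (hprev m hm hle).trans (mul_le_mul_of_nonneg_right (le_max_left _ _) (hF0 _))

/-- The coefficients of `startedBdf2`. -/
noncomputable def startedBdf2Coeff (n k : ℕ) : ℝ :=
  (if k = n then (if n = 1 then 1 else 3 / 2) else 0) + (if k + 1 = n then -2 else 0) +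
    (if k + 2 = n then 1 / 2 else 0)

theorem startedBdf2_eq_sum {U : ℕ → E} (h0 : U 0 = 0) {n : ℕ} (hn : 1 ≤ n) :
    startedBdf2 U n = ∑ k ∈ Finset.Icc 1 n, startedBdf2Coeff n k • U k := by
  have hs : ∀ (p : ℕ) (x : ℝ), p ≤ n →
      ∑ k ∈ Finset.Icc 1 n, (if k + p = n then x else 0) • U k = x • U (n - p) := by
    intro p x hp
    -- For `p = n` the term has index `0`, outside the summation range, and `U 0 = 0` makes up for
    -- it.
    rcases Nat.eq_or_lt_of_le hp with rfl | hlt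
    · rw [Nat.sub_self, h0, smul_zero]
      refine Finset.sum_eq_zero fun k hk => ?_
      rw [Finset.mem_Icc] at hk
      rw [if_neg (by omega), zero_smul]
    · rw [Finset.sum_eq_single (n - p)]
      · rw [if_pos (by omega)]
      · intro k _ hk
        rw [if_neg (by omega), zero_smul]
      · intro hk
        simp at hk
        omega
  rcases Nat.eq_or_lt_of_le hn with rfl | hlt
  · simp [startedBdf2, startedBdf2Coeff]
  · have h2 := hs 0 (if n = 1 then 1 else 3 / 2) (by omega)
    have h3 := hs 1 (-2) hn
    have h4 := hs 2 (1 / 2) (by omega)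
    simp only [startedBdf2Coeff, add_smul, Finset.sum_add_distrib]
    rw [h3, h4]
    simp only [Nat.add_zero, Nat.sub_zero] at h2
    rw [h2, startedBdf2, if_neg (by omega), if_neg (by omega), neg_smul, sub_eq_add_neg]

end FixedStep

/-! ### The scaled scheme and the sign of its fractional term -/

section Scheme

variable {d : ℕ} {Ω : Set (EuclideanSpace ℝ (Fin d))} {T κ : ℝ} {α : ℝ → ℝ} {N : ℕ}
  {F : ℝ → L2 Ω} {U AU : ℕ → L2 Ω}

theorem cqWeight_zero_pos (μ : ℝ) : 0 < cqWeight μ 0 := by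
  simp [cqWeight, binomCoeff]
  positivity

theorem IsSchemeSolution.scaled_equation (hΩ : IsOpen Ω) (hT : 0 < T) (hN : 1 ≤ N)
    (h : IsSchemeSolution Ω T κ α N F U AU) (n : ℕ) (hn : 1 ≤ n) (hnN : n ≤ N) :
    startedBdf2 U n + ∑ k ∈ Finset.Icc 1 n, abelWeight (wgt α (T / N)) (n - k) • U k -
      (T / N * (κ * (T / N) ^ (α 0 - 1))) •
        ∑ j ∈ Finset.Icc 1 n, cqWeight (α 0 - 1) (n - j) • AU j =
      (T / N) • F (n * (T / N)) := by
  have hN' : (0 : ℝ) < N := by exact_mod_cast hN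
  have hτ : T / N ≠ 0 := (div_pos hT hN').ne'
  have hAU0 : AU 0 = 0 := by
    refine IsDirichletLaplacian.eq_zero hΩ ?_
    have := h.laplacian 0 (Nat.zero_le _)
    rwa [h.initial] at this
  have hq : ∀ k, (T / N) • diffQuot (T / N) U k = U k - U (k - 1) := fun k => by
    rw [diffQuot, smul_inv_smul₀ hτ]
  rw [← sum_smul_sub_eq_sum_abelWeight _ h.initial]
  have hconv : ∑ k ∈ Finset.Icc 1 n, wgt α (T / N) (n - k) • (U k - U (k - 1)) =
      (T / N) • ∑ k ∈ Finset.Icc 1 n, wgt α (T / N) (n - k) • diffQuot (T / N) U k := by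
    rw [Finset.smul_sum]
    refine Finset.sum_congr rfl fun k _ => ?_
    rw [smul_comm, hq]
  rw [hconv, mul_smul]
  rcases Nat.eq_or_lt_of_le hn with rfl | hlt
  · have h1 := h.first
    rw [hAU0, smul_zero, add_zero] at h1
    rw [Nat.cast_one, one_mul, ← h1, smul_sub, smul_add, hq]
    simp [startedBdf2, h.initial]
  · have h2 := h.step n hlt hnN
    rw [hAU0, smul_zero, add_zero] at h2
    have hb : (T / N) • bdf2 (T / N) U n = startedBdf2 U n := by
      rw [bdf2, smul_sub, smul_comm (T / N : ℝ) (3 / 2 : ℝ), smul_comm (T / N : ℝ) (1 / 2 : ℝ), hq,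
        hq, startedBdf2, if_neg (by omega), Nat.sub_sub]
      module
    rw [← h2, smul_sub, smul_add, hb]

theorem IsSchemeSolution.exists_gradient (h : IsSchemeSolution Ω T κ α N F U AU) :
    ∃ G : ℕ → Fin d → L2 Ω, ∀ j ≤ N, ∀ k ≤ N, ⟪AU j, U k⟫ = -∑ i, ⟪G j i, G k i⟫ := by
  have : ∀ n, ∃ G : Fin d → L2 Ω, n ≤ N → MemH10WithGradient Ω (U n) G ∧
    ∀ φ, IsTestFunction Ω φ →
      ∑ i : Fin d, ∫ x in Ω, G i x * partialDeriv i φ x = -∫ x in Ω, AU n x * φ x := by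
    intro n
    by_cases hn : n ≤ N
    · obtain ⟨G, hG⟩ := h.laplacian n hn
      exact ⟨G, fun _ => hG⟩
    · exact ⟨0, fun h => absurd h hn⟩
  choose G hG using this
  exact ⟨G, fun j hj k hk => inner_eq_neg_sum_inner_gradient (hG j hj).2 (hG k hk).1⟩

/-- Green's formula reduces the claim to the positive type of the weights, applied to each component
of the gradients. -/
theorem IsSchemeSolution.conv_inner_nonpos (h : IsSchemeSolution Ω T κ α N F U AU) {μ : ℝ}
    (h0 : 0 ≤ μ) (h1 : μ ≤ 1) (m : ℕ) (hm : m ≤ N) :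
    ∑ n ∈ Finset.Icc 1 m, ⟪∑ j ∈ Finset.Icc 1 n, cqWeight μ (n - j) • AU j, U n⟫ ≤ 0 := by
  obtain ⟨G, hG⟩ := h.exists_gradient
  have e : ∑ n ∈ Finset.Icc 1 m, ⟪∑ j ∈ Finset.Icc 1 n, cqWeight μ (n - j) • AU j, U n⟫ =
      -∑ i, ∑ n ∈ Finset.Icc 1 m, ∑ j ∈ Finset.Icc 1 n,
        cqWeight μ (n - j) * ⟪G j i, G n i⟫ := by
    rw [Finset.sum_comm, ← Finset.sum_neg_distrib]
    refine Finset.sum_congr rfl fun n hn => ?_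
    rw [Finset.sum_comm, sum_inner, ← Finset.sum_neg_distrib]
    refine Finset.sum_congr rfl fun j hj => ?_
    rw [Finset.mem_Icc] at hn hj
    rw [real_inner_smul_left, hG j (by omega) n (by omega), ← Finset.mul_sum, mul_neg]
  rw [e]
  exact neg_nonpos.2 (Finset.sum_nonneg fun i _ =>
    sum_cqWeight_conv_inner_nonneg h0 h1 m fun n => G n i)

theorem IsSchemeSolution.dissipative (h : IsSchemeSolution Ω T κ α N F U AU) (m : ℕ) (hm : m ≤ N)
    (r : ℕ → ℝ) :
    ⟪∑ k ∈ Finset.Icc 1 m, r k • AU k, ∑ k ∈ Finset.Icc 1 m, r k • U k⟫ ≤ 0 := by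
  obtain ⟨G, hG⟩ := h.exists_gradient
  have e : ⟪∑ k ∈ Finset.Icc 1 m, r k • AU k, ∑ k ∈ Finset.Icc 1 m, r k • U k⟫ =
      -∑ i, ⟪∑ k ∈ Finset.Icc 1 m, r k • G k i, ∑ k ∈ Finset.Icc 1 m, r k • G k i⟫ := by
    simp only [inner_sum, sum_inner]
    conv_rhs => rw [Finset.sum_comm]
    rw [← Finset.sum_neg_distrib]
    refine Finset.sum_congr rfl fun n hn => ?_
    conv_rhs => rw [Finset.sum_comm]
    rw [← Finset.sum_neg_distrib]
    refine Finset.sum_congr rfl fun j hj => ?_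
    rw [Finset.mem_Icc] at hn hj
    simp only [real_inner_smul_left, real_inner_smul_right, ← Finset.mul_sum]
    rw [hG j (by omega) n (by omega)]
    ring
  rw [e]
  exact neg_nonpos.2 (Finset.sum_nonneg fun i _ => real_inner_self_nonneg)

end Scheme

/-! ### Functions with two bounded derivatives on an open interval -/

/-- `f` is twice differentiable on `(0,T)`, and `f`, `f'`, `f''` are bounded there. -/
def HasBoundedSecondDeriv (T : ℝ) (f : ℝ → ℝ) : Prop :=
  ∃ (f₁ f₂ : ℝ → ℝ) (C : ℝ), ∀ x ∈ Ioo 0 T, HasDerivAt f (f₁ x) x ∧ HasDerivAt f₁ (f₂ x) x ∧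
    |f x| ≤ C ∧ |f₁ x| ≤ C ∧ |f₂ x| ≤ C

theorem HasBoundedSecondDeriv.mul {T : ℝ} {f g : ℝ → ℝ} (hf : HasBoundedSecondDeriv T f)
    (hg : HasBoundedSecondDeriv T g) : HasBoundedSecondDeriv T (fun x => f x * g x) := by
  obtain ⟨f₁, f₂, C, hf⟩ := hf
  obtain ⟨g₁, g₂, D, hg⟩ := hg
  refine ⟨fun x => f₁ x * g x + f x * g₁ x,
    fun x => (f₂ x * g x + f₁ x * g₁ x) + (f₁ x * g₁ x + f x * g₂ x), 4 * (C * D),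
    fun x hx => ?_⟩
  obtain ⟨a1, a2, a3, a4, a5⟩ := hf x hx
  obtain ⟨b1, b2, b3, b4, b5⟩ := hg x hx
  have hC : 0 ≤ C := (abs_nonneg _).trans a3
  have hD : 0 ≤ D := (abs_nonneg _).trans b3
  have hCD : 0 ≤ C * D := mul_nonneg hC hD
  have hp : ∀ a b : ℝ, |a| ≤ C → |b| ≤ D → |a * b| ≤ C * D := fun a b ha hb => by
    rw [abs_mul]
    exact mul_le_mul ha hb (abs_nonneg _) hC
  refine ⟨a1.mul b1, (a2.mul b1).add (a1.mul b2), ?_, ?_, ?_⟩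
  · linarith [hp _ _ a3 b3]
  · linarith [abs_add_le (f₁ x * g x) (f x * g₁ x), hp _ _ a4 b3, hp _ _ a3 b4]
  · linarith [abs_add_le (f₂ x * g x + f₁ x * g₁ x) (f₁ x * g₁ x + f x * g₂ x),
      abs_add_le (f₂ x * g x) (f₁ x * g₁ x), abs_add_le (f₁ x * g₁ x) (f x * g₂ x),
      hp _ _ a5 b3, hp _ _ a4 b4, hp _ _ a3 b5]

theorem HasBoundedSecondDeriv.comp {T : ℝ} {f R : ℝ → ℝ} (hR : ContDiff ℝ 2 R)
    (hf : HasBoundedSecondDeriv T f) : HasBoundedSecondDeriv T (fun x => R (f x)) := by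
  obtain ⟨f₁, f₂, C, hf⟩ := hf
  have hR1 : ContDiff ℝ 1 (deriv R) := by
    have : ContDiff ℝ (1 + 1) R := by simpa [one_add_one_eq_two] using hR
    exact (contDiff_succ_iff_deriv.1 this).2.2
  have hd0 : Differentiable ℝ R := hR.differentiable (by simp)
  have hd1 : Differentiable ℝ (deriv R) := hR1.differentiable (by simp)
  have hc2 : Continuous (deriv (deriv R)) := hR1.continuous_deriv le_rfl
  have hcpt : IsCompact (Icc (-C) C) := isCompact_Icc
  obtain ⟨D0, h0⟩ := hcpt.exists_bound_of_continuousOn hd0.continuous.continuousOn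
  obtain ⟨D1, h1⟩ := hcpt.exists_bound_of_continuousOn hd1.continuous.continuousOn
  obtain ⟨D2, h2⟩ := hcpt.exists_bound_of_continuousOn hc2.continuousOn
  refine ⟨fun x => deriv R (f x) * f₁ x,
    fun x => deriv (deriv R) (f x) * f₁ x * f₁ x + deriv R (f x) * f₂ x,
    D0 + D1 * C + D2 * C * C, fun x hx => ?_⟩
  obtain ⟨a1, a2, a3, a4, a5⟩ := hf x hx
  have hC : 0 ≤ C := (abs_nonneg _).trans a3
  have hm : f x ∈ Icc (-C) C := abs_le.1 a3
  have e0 : |R (f x)| ≤ D0 := h0 _ hm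
  have e1 : |deriv R (f x)| ≤ D1 := h1 _ hm
  have e2 : |deriv (deriv R) (f x)| ≤ D2 := h2 _ hm
  have hD0 : 0 ≤ D0 := (abs_nonneg _).trans e0
  have hD1 : 0 ≤ D1 := (abs_nonneg _).trans e1
  have hD2 : 0 ≤ D2 := (abs_nonneg _).trans e2
  have p1 : 0 ≤ D1 * C := by positivity
  have p2 : 0 ≤ D2 * C * C := by positivity
  have q1 : ∀ b, |b| ≤ C → |deriv R (f x) * b| ≤ D1 * C := fun b hb => by
    rw [abs_mul]; exact mul_le_mul e1 hb (abs_nonneg _) hD1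
  refine ⟨(hd0 _).hasDerivAt.comp x a1,
    ((((hd1 _).hasDerivAt.comp x a1).mul a2)), by linarith, ?_, ?_⟩
  · linarith [q1 _ a4]
  · have q2 : |deriv (deriv R) (f x) * f₁ x * f₁ x| ≤ D2 * C * C := by
      rw [abs_mul, abs_mul]; gcongr
    linarith [abs_add_le (deriv (deriv R) (f x) * f₁ x * f₁ x) (deriv R (f x) * f₂ x), q1 _ a5]

/-- Mean value theorem, used twice for the second difference. All intermediate points are interior,
so continuity suffices at the end points, where the derivatives may fail to exist. -/
theorem HasBoundedSecondDeriv.exists_difference_bound {T : ℝ} {f : ℝ → ℝ}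
    (hf : HasBoundedSecondDeriv T f) (hc : ContinuousOn f (Icc 0 T)) :
    ∃ C : ℝ, 0 ≤ C ∧ (∀ s h, 0 ≤ s → 0 ≤ h → s + h ≤ T → |f (s + h) - f s| ≤ C * h) ∧
      ∀ s h, 0 ≤ s → 0 ≤ h → s + 2 * h ≤ T →
        |f (s + 2 * h) - 2 * f (s + h) + f s| ≤ C * h ^ 2 := by
  obtain ⟨f₁, f₂, C, hf⟩ := hf
  refine ⟨|C|, abs_nonneg _, fun s h hs hh hT => ?_, fun s h hs hh hT => ?_⟩
  · rcases hh.eq_or_lt with rfl | hh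
    · simp
    have hsub : ∀ x ∈ Ioo s (s + h), x ∈ Ioo 0 T := fun x hx => ⟨by linarith [hx.1], by
      linarith [hx.2]⟩
    obtain ⟨c, hc', he⟩ := exists_hasDerivAt_eq_slope f f₁ (show s < s + h by linarith)
      (hc.mono (Icc_subset_Icc hs hT)) fun x hx => (hf x (hsub x hx)).1
    rw [add_sub_cancel_left, eq_div_iff hh.ne'] at he
    rw [← he, abs_mul, abs_of_pos hh]
    exact mul_le_mul_of_nonneg_right ((hf c (hsub c hc')).2.2.2.1.trans (le_abs_self _)) hh.le
  · rcases hh.eq_or_lt with rfl | hh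
    · simp; ring
    have hder : ∀ x ∈ Ioo s (s + h),
        HasDerivAt (fun x => f (x + h) - f x) (f₁ (x + h) - f₁ x) x := fun x hx =>
      (HasDerivAt.comp_add_const x h (hf (x + h) ⟨by linarith [hx.1], by linarith [hx.2]⟩).1).sub
        (hf x ⟨by linarith [hx.1], by linarith [hx.2]⟩).1
    have hcont : ContinuousOn (fun x => f (x + h) - f x) (Icc s (s + h)) := by
      refine ContinuousOn.sub (hc.comp (by fun_prop) fun x hx => ?_)
        (hc.mono (Icc_subset_Icc hs (by linarith)))
      exact ⟨by linarith [hx.1], by linarith [hx.2]⟩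
    obtain ⟨c, hc', he⟩ := exists_hasDerivAt_eq_slope _ (fun x => f₁ (x + h) - f₁ x)
      (show s < s + h by linarith) hcont hder
    have hsub : ∀ x ∈ Icc c (c + h), x ∈ Ioo 0 T := fun x hx => ⟨by linarith [hx.1, hc'.1], by
      linarith [hx.2, hc'.2]⟩
    obtain ⟨c', hc'', he'⟩ := exists_hasDerivAt_eq_slope f₁ f₂ (show c < c + h by linarith)
      (fun x hx => (hf x (hsub x hx)).2.1.continuousAt.continuousWithinAt)
      fun x hx => (hf x (hsub x (Ioo_subset_Icc_self hx))).2.1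
    rw [add_sub_cancel_left, eq_div_iff hh.ne'] at he he'
    have e : f (s + 2 * h) - 2 * f (s + h) + f s = f₂ c' * h ^ 2 := by
      rw [show s + 2 * h = s + h + h by ring]
      linear_combination -he - h * he'
    rw [e, abs_mul, abs_of_nonneg (sq_nonneg h)]
    exact mul_le_mul_of_nonneg_right
      ((hf c' (hsub c' (Ioo_subset_Icc_self hc''))).2.2.2.2.trans (le_abs_self _)) (sq_nonneg h)

/-- The reciprocal Gamma function is entire, so smoothness holds on the whole line, across the poles
of `Γ`. -/
theorem contDiff_inv_Gamma : ContDiff ℝ 2 fun x : ℝ => (Real.Gamma x)⁻¹ := by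
  have h1 : ContDiff ℝ 2 fun s : ℂ => (Complex.Gamma s)⁻¹ :=
    Complex.differentiable_one_div_Gamma.contDiff.restrict_scalars ℝ
  have h2 := Complex.reCLM.contDiff.comp (h1.comp Complex.ofRealCLM.contDiff)
  have e : (fun x : ℝ => (Real.Gamma x)⁻¹) =
      Complex.reCLM ∘ (fun s : ℂ => (Complex.Gamma s)⁻¹) ∘ Complex.ofRealCLM := by
    funext x
    simp [Complex.Gamma_ofReal, ← Complex.ofReal_inv, -Complex.inv_re]
  rw [e]
  exact h2

/-! ### The exponent function -/

section Exponent

variable {T : ℝ} {α : ℝ → ℝ}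

theorem abs_sub_le_of_hasDerivWithinAt {f f' : ℝ → ℝ} {C t : ℝ} (ht0 : 0 ≤ t)
    (hf : ∀ x ∈ Icc 0 t, HasDerivWithinAt f (f' x) (Icc 0 t) x) (hC : ∀ x ∈ Icc 0 t, |f' x| ≤ C) :
    |f t - f 0| ≤ C * t := by
  have := (convex_Icc 0 t).norm_image_sub_le_of_norm_hasDerivWithin_le hf hC
    (left_mem_Icc.2 ht0) (right_mem_Icc.2 ht0)
  simpa [abs_of_nonneg ht0] using this

theorem IsAdmissibleExponent.hasDerivWithinAt (hα : IsAdmissibleExponent T α) {j : ℕ}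
    (hj : j < 3) {t : ℝ} (ht : t ∈ Icc 0 T) :
    HasDerivWithinAt (iteratedDerivWithin j α (Icc 0 T))
      (iteratedDerivWithin (j + 1) α (Icc 0 T) t) (Icc 0 T) t := by
  rw [iteratedDerivWithin_succ]
  exact (hα.differentiableOn j hj t ht).hasDerivWithinAt

theorem IsAdmissibleExponent.continuousOn (hα : IsAdmissibleExponent T α) :
    ContinuousOn α (Icc 0 T) := by
  have := (hα.differentiableOn 0 (by norm_num)).continuousOn
  simpa using this

/-- The bounds of `α - α(0)` and its derivatives near `0`. -/
theorem IsAdmissibleExponent.exists_bounds (hα : IsAdmissibleExponent T α)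
    (hα1 : iteratedDerivWithin 1 α (Icc 0 T) 0 = 0)
    (hα2 : iteratedDerivWithin 2 α (Icc 0 T) 0 = 0) :
    ∃ (a₁ a₂ : ℝ → ℝ) (L : ℝ), 0 ≤ L ∧
      (∀ t ∈ Ioo 0 T, HasDerivAt α (a₁ t) t ∧ HasDerivAt a₁ (a₂ t) t) ∧
      ∀ t ∈ Icc 0 T, |a₂ t| ≤ L * t ∧ |a₁ t| ≤ L * t ^ 2 ∧ |α t - α 0| ≤ L * t ^ 3 := by
  obtain ⟨L, hL, hb⟩ := hα.bounded
  set a₁ := iteratedDerivWithin 1 α (Icc 0 T) with ha₁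
  set a₂ := iteratedDerivWithin 2 α (Icc 0 T) with ha₂
  set a₃ := iteratedDerivWithin 3 α (Icc 0 T) with ha₃
  have d0 : ∀ t ∈ Icc 0 T, HasDerivWithinAt α (a₁ t) (Icc 0 T) t := fun t ht => by
    have := hα.hasDerivWithinAt (j := 0) (by norm_num) ht
    rwa [iteratedDerivWithin_zero] at this
  have d1 : ∀ t ∈ Icc 0 T, HasDerivWithinAt a₁ (a₂ t) (Icc 0 T) t := fun t ht =>
    hα.hasDerivWithinAt (j := 1) (by norm_num) ht
  have d2 : ∀ t ∈ Icc 0 T, HasDerivWithinAt a₂ (a₃ t) (Icc 0 T) t := fun t ht =>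
    hα.hasDerivWithinAt (j := 2) (by norm_num) ht
  have hsub : ∀ {t}, t ∈ Icc 0 T → Icc 0 t ⊆ Icc 0 T := fun ht => Icc_subset_Icc le_rfl ht.2
  have b2 : ∀ t ∈ Icc 0 T, |a₂ t| ≤ L * t := fun t ht => by
    have := abs_sub_le_of_hasDerivWithinAt (C := L) ht.1
      (fun x hx => (d2 x (hsub ht hx)).mono (hsub ht)) fun x hx => by
        linarith [hb x (hsub ht hx), abs_nonneg (a₁ x), abs_nonneg (a₂ x)]
    rwa [hα2, sub_zero] at this
  have b1 : ∀ t ∈ Icc 0 T, |a₁ t| ≤ L * t ^ 2 := fun t ht => by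
    have := abs_sub_le_of_hasDerivWithinAt (C := L * t) ht.1
      (fun x hx => (d1 x (hsub ht hx)).mono (hsub ht)) fun x hx =>
        (b2 x (hsub ht hx)).trans (mul_le_mul_of_nonneg_left hx.2 hL.le)
    rw [hα1, sub_zero] at this
    linarith
  have b0 : ∀ t ∈ Icc 0 T, |α t - α 0| ≤ L * t ^ 3 := fun t ht => by
    have := abs_sub_le_of_hasDerivWithinAt (C := L * t ^ 2) ht.1
      (fun x hx => (d0 x (hsub ht hx)).mono (hsub ht)) fun x hx =>
        (b1 x (hsub ht hx)).trans
          (mul_le_mul_of_nonneg_left (pow_le_pow_left₀ hx.1 hx.2 2) hL.le)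
    linarith
  exact ⟨a₁, a₂, L, hL.le, fun t ht => ⟨(d0 t (Ioo_subset_Icc_self ht)).hasDerivAt
    (Icc_mem_nhds ht.1 ht.2), (d1 t (Ioo_subset_Icc_self ht)).hasDerivAt
    (Icc_mem_nhds ht.1 ht.2)⟩, fun t ht => ⟨b2 t ht, b1 t ht, b0 t ht⟩⟩

theorem exists_abs_mul_log_le (T : ℝ) : ∃ D : ℝ, 0 ≤ D ∧ ∀ x ∈ Icc 0 T, |x * Real.log x| ≤ D := by
  obtain ⟨D, hD⟩ := (isCompact_Icc (a := (0 : ℝ)) (b := T)).exists_bound_of_continuousOn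
    Real.continuous_mul_log.continuousOn
  exact ⟨|D|, abs_nonneg _, fun x hx => (hD x hx).trans (le_abs_self _)⟩

theorem IsAdmissibleExponent.hasBoundedSecondDeriv (hα : IsAdmissibleExponent T α)
    (hα1 : iteratedDerivWithin 1 α (Icc 0 T) 0 = 0)
    (hα2 : iteratedDerivWithin 2 α (Icc 0 T) 0 = 0) : HasBoundedSecondDeriv T α := by
  obtain ⟨a₁, a₂, L, hL, hd, hb⟩ := hα.exists_bounds hα1 hα2
  refine ⟨a₁, a₂, 2 + L * T ^ 2 + L * T, fun x hx => ?_⟩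
  obtain ⟨h1, h2⟩ := hd x hx
  obtain ⟨b2, b1, -⟩ := hb x (Ioo_subset_Icc_self hx)
  obtain ⟨c1, c2⟩ := hα.mem_Ioo x (Ioo_subset_Icc_self hx)
  have hT : 0 ≤ T := (hx.1.trans hx.2).le
  have p1 : 0 ≤ L * T := by positivity
  have p2 : 0 ≤ L * T ^ 2 := by positivity
  have q1 : L * x ≤ L * T := mul_le_mul_of_nonneg_left hx.2.le hL
  have q2 : L * x ^ 2 ≤ L * T ^ 2 :=
    mul_le_mul_of_nonneg_left (pow_le_pow_left₀ hx.1.le hx.2.le 2) hL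
  refine ⟨h1, h2, ?_, by linarith, by linarith⟩
  rw [abs_of_pos (by linarith)]
  linarith

/-- Two derivatives produce `α'' log s`, `α'/s` and `(α - α(0))/s²`. The vanishing orders `1`, `2`,
`3` of `α''`, `α'` and `α - α(0)` compensate each singularity, since `s log s` is bounded. -/
theorem IsAdmissibleExponent.hasBoundedSecondDeriv_mul_log (hα : IsAdmissibleExponent T α)
    (hα1 : iteratedDerivWithin 1 α (Icc 0 T) 0 = 0)
    (hα2 : iteratedDerivWithin 2 α (Icc 0 T) 0 = 0) :
    HasBoundedSecondDeriv T fun s => (α s - α 0) * Real.log s := by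
  obtain ⟨a₁, a₂, L, hL, hd, hb⟩ := hα.exists_bounds hα1 hα2
  obtain ⟨D, hD, hlog⟩ := exists_abs_mul_log_le T
  refine ⟨fun s => a₁ s * Real.log s + (α s - α 0) * s⁻¹,
    fun s => (a₂ s * Real.log s + a₁ s * s⁻¹) + (a₁ s * s⁻¹ + (α s - α 0) * (-(s ^ 2)⁻¹)),
    L * T ^ 2 * D + (L * T * D + L * T ^ 2) + (L * D + 3 * (L * T)), fun x hx => ?_⟩
  obtain ⟨h1, h2⟩ := hd x hx
  obtain ⟨b2, b1, b0⟩ := hb x (Ioo_subset_Icc_self hx)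
  have hl := hlog x (Ioo_subset_Icc_self hx)
  have hx0 : 0 < x := hx.1
  have hT : 0 < T := hx.1.trans hx.2
  have hdl := Real.hasDerivAt_log hx0.ne'
  have hdi := hasDerivAt_inv hx0.ne'
  rw [abs_mul, abs_of_pos hx0] at hl
  have key : ∀ (p : ℕ) (a : ℝ), |a| ≤ L * x ^ (p + 1) →
      |a * Real.log x| ≤ L * T ^ p * D := fun p a ha => by
    rw [abs_mul]
    calc |a| * |Real.log x| ≤ L * x ^ (p + 1) * |Real.log x| := by gcongr
      _ = L * x ^ p * (x * |Real.log x|) := by ring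
      _ ≤ L * T ^ p * D := by
        have := hx.2.le
        gcongr
  have key' : ∀ (p : ℕ) (a : ℝ), |a| ≤ L * x ^ (p + 1) → |a * x⁻¹| ≤ L * T ^ p := fun p a ha => by
    rw [abs_mul, abs_of_pos (inv_pos.2 hx0)]
    calc |a| * x⁻¹ ≤ L * x ^ (p + 1) * x⁻¹ := by gcongr
      _ = L * x ^ p := by rw [pow_succ, mul_assoc, mul_assoc, mul_inv_cancel₀ hx0.ne', mul_one]
      _ ≤ L * T ^ p := by
        have := hx.2.le
        gcongr
  have k0 := key 2 _ b0
  have k1 := key 1 _ b1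
  have k2 := key 0 (a₂ x) (by simpa using b2)
  have k3 := key' 2 _ b0
  have k4 := key' 1 _ b1
  have k5 : |(α x - α 0) * (-(x ^ 2)⁻¹)| ≤ L * T := by
    rw [abs_mul, abs_neg, abs_of_pos (show 0 < (x ^ 2)⁻¹ by positivity)]
    calc |α x - α 0| * (x ^ 2)⁻¹ ≤ L * x ^ 3 * (x ^ 2)⁻¹ := by gcongr
      _ = L * x := by field_simp
      _ ≤ L * T := mul_le_mul_of_nonneg_left hx.2.le hL
  have p0 : 0 ≤ L * T ^ 2 * D := by positivity
  have p1 : 0 ≤ L * T * D + L * T ^ 2 := by positivity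
  have p2 : 0 ≤ L * D + 3 * (L * T) := by positivity
  simp only [pow_one, pow_zero, mul_one] at k0 k1 k2 k3 k4 k5
  refine ⟨?_, ?_, by linarith, ?_, ?_⟩
  · exact (h1.sub_const (α 0)).mul hdl
  · exact (h2.mul hdl).add ((h1.sub_const (α 0)).mul hdi) |>.congr_deriv (by ring)
  · linarith [abs_add_le (a₁ x * Real.log x) ((α x - α 0) * x⁻¹)]
  · linarith [abs_add_le (a₂ x * Real.log x + a₁ x * x⁻¹)
      (a₁ x * x⁻¹ + (α x - α 0) * (-(x ^ 2)⁻¹)), abs_add_le (a₂ x * Real.log x) (a₁ x * x⁻¹),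
      abs_add_le (a₁ x * x⁻¹) ((α x - α 0) * (-(x ^ 2)⁻¹))]

theorem IsAdmissibleExponent.continuousOn_mul_log (hα : IsAdmissibleExponent T α)
    (hα1 : iteratedDerivWithin 1 α (Icc 0 T) 0 = 0)
    (hα2 : iteratedDerivWithin 2 α (Icc 0 T) 0 = 0) :
    ContinuousOn (fun s => (α s - α 0) * Real.log s) (Icc 0 T) := by
  obtain ⟨a₁, a₂, L, hL, hd, hb⟩ := hα.exists_bounds hα1 hα2
  intro x hx
  rcases hx.1.eq_or_lt with h0 | hx0
  -- The convention `Real.log 0 = 0` gives the value `0` at the origin, which is also the limit.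
  · rw [← h0, ContinuousWithinAt, Real.log_zero, mul_zero]
    have hlim : Tendsto (fun s : ℝ => L * s ^ 2 * |s * Real.log s|) (𝓝[Icc 0 T] 0) (𝓝 0) := by
      have hc : Continuous fun s : ℝ => L * s ^ 2 * |s * Real.log s| := by
        have := Real.continuous_mul_log
        fun_prop
      have := hc.tendsto 0
      simp only [Real.log_zero, mul_zero, abs_zero] at this
      exact this.mono_left nhdsWithin_le_nhds
    refine squeeze_zero_norm' ?_ hlim
    filter_upwards [self_mem_nhdsWithin] with s hs
    rw [norm_mul, Real.norm_eq_abs, Real.norm_eq_abs, abs_mul, abs_of_nonneg hs.1]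
    calc |α s - α 0| * |Real.log s| ≤ L * s ^ 3 * |Real.log s| := by
          gcongr
          exact (hb s hs).2.2
      _ = _ := by ring
  · exact ((hα.continuousOn x hx).sub continuousWithinAt_const).mul
      (Real.continuousAt_log hx0.ne').continuousWithinAt

end Exponent

/-! ### The generalized identity function -/

/-- The weight of the integral that defines `genId`. -/
noncomputable def genIdWeight (a z : ℝ) : ℝ :=
  (Real.Gamma (a - 1))⁻¹ * (z ^ (1 - a) * (1 - z) ^ (a - 2))

/-- The factor of the integrand of `genId` that depends on `t z` only. -/
noncomputable def genIdProfile (α : ℝ → ℝ) (s : ℝ) : ℝ :=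
  Real.exp (-((α s - α 0) * Real.log s)) * (Real.Gamma (2 - α s))⁻¹

theorem ofReal_betaIntegrand (u v : ℝ) {x : ℝ} (hx : x ∈ Icc (0 : ℝ) 1) :
    (x : ℂ) ^ ((u : ℂ) - 1) * (1 - (x : ℂ)) ^ ((v : ℂ) - 1) =
      ((x ^ (u - 1) * (1 - x) ^ (v - 1) : ℝ) : ℂ) := by
  rw [Complex.ofReal_mul, Complex.ofReal_cpow hx.1, Complex.ofReal_cpow (by linarith [hx.2])]
  push_cast
  rfl

theorem intervalIntegrable_rpow_mul_one_sub_rpow {u v : ℝ} (hu : 0 < u) (hv : 0 < v) :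
    IntervalIntegrable (fun x : ℝ => x ^ (u - 1) * (1 - x) ^ (v - 1)) volume 0 1 := by
  have h := Complex.betaIntegral_convergent (u := (u : ℂ)) (v := (v : ℂ)) (by simpa) (by simpa)
  rw [intervalIntegrable_iff] at h ⊢
  refine (h.re).congr ?_
  filter_upwards [ae_restrict_mem measurableSet_uIoc] with x hx
  rw [uIoc_of_le zero_le_one] at hx
  rw [ofReal_betaIntegrand u v (Ioc_subset_Icc_self hx)]
  exact Complex.ofReal_re _

theorem integral_rpow_mul_one_sub_rpow {u v : ℝ} (hu : 0 < u) (hv : 0 < v) (huv : u + v = 1) :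
    ∫ x in (0 : ℝ)..1, x ^ (u - 1) * (1 - x) ^ (v - 1) = Real.Gamma u * Real.Gamma v := by
  have h := Complex.Gamma_mul_Gamma_eq_betaIntegral (s := (u : ℂ)) (t := (v : ℂ))
    (by simpa) (by simpa)
  have e : (u : ℂ) + v = 1 := by exact_mod_cast huv
  rw [e, Complex.Gamma_one, one_mul, Complex.betaIntegral, Complex.Gamma_ofReal,
    Complex.Gamma_ofReal] at h
  have h2 : ∫ x in (0 : ℝ)..1, (x : ℂ) ^ ((u : ℂ) - 1) * (1 - (x : ℂ)) ^ ((v : ℂ) - 1) =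
      ∫ x in (0 : ℝ)..1, ((x ^ (u - 1) * (1 - x) ^ (v - 1) : ℝ) : ℂ) :=
    intervalIntegral.integral_congr fun x hx => ofReal_betaIntegrand u v
      (by rwa [uIcc_of_le zero_le_one] at hx)
  rw [h2, intervalIntegral.integral_ofReal] at h
  exact_mod_cast h.symm

section GenIdWeight

variable {a : ℝ}

theorem intervalIntegrable_genIdWeight (h1 : 1 < a) (h2 : a < 2) :
    IntervalIntegrable (genIdWeight a) volume 0 1 := by
  have := (intervalIntegrable_rpow_mul_one_sub_rpow (u := 2 - a) (v := a - 1) (by linarith)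
    (by linarith)).const_mul (Real.Gamma (a - 1))⁻¹
  rw [show 2 - a - 1 = 1 - a by ring, show a - 1 - 1 = a - 2 by ring] at this
  exact this

theorem integral_genIdWeight (h1 : 1 < a) (h2 : a < 2) :
    ∫ z in (0 : ℝ)..1, genIdWeight a z = Real.Gamma (2 - a) := by
  have := integral_rpow_mul_one_sub_rpow (u := 2 - a) (v := a - 1) (by linarith)
    (by linarith) (by ring)
  rw [show 2 - a - 1 = 1 - a by ring, show a - 1 - 1 = a - 2 by ring] at this
  have hG : Real.Gamma (a - 1) ≠ 0 := (Real.Gamma_pos_of_pos (by linarith)).ne'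
  simp only [genIdWeight]
  rw [intervalIntegral.integral_const_mul, this]
  field_simp

theorem genIdWeight_nonneg (h1 : 1 < a) {z : ℝ} (hz : z ∈ Icc (0 : ℝ) 1) : 0 ≤ genIdWeight a z := by
  have hG : 0 < Real.Gamma (a - 1) := Real.Gamma_pos_of_pos (by linarith)
  have := Real.rpow_nonneg hz.1 (1 - a)
  have := Real.rpow_nonneg (sub_nonneg.2 hz.2) (a - 2)
  unfold genIdWeight
  positivity

theorem genIdWeight_pos (h1 : 1 < a) {z : ℝ} (hz : z ∈ Ioo (0 : ℝ) 1) : 0 < genIdWeight a z := by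
  have hG : 0 < Real.Gamma (a - 1) := Real.Gamma_pos_of_pos (by linarith)
  have := Real.rpow_pos_of_pos hz.1 (1 - a)
  have := Real.rpow_pos_of_pos (sub_pos.2 hz.2) (a - 2)
  unfold genIdWeight
  positivity

end GenIdWeight

section GenId

variable {T : ℝ} {α : ℝ → ℝ}

theorem genId_eq_integral (α : ℝ → ℝ) {t : ℝ} (ht : 0 ≤ t) :
    genId α t = ∫ z in (0 : ℝ)..1, genIdProfile α (t * z) * genIdWeight (α 0) z := by
  refine intervalIntegral.integral_congr fun z hz => ?_
  rw [uIcc_of_le zero_le_one] at hz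
  have e : (t * z) ^ (α 0 - α (t * z)) =
      Real.exp (-((α (t * z) - α 0) * Real.log (t * z))) := by
    -- At `t z = 0` both sides are `1`: the power is `0 ^ 0`, and the exponent on the right
    -- vanishes.
    rcases (mul_nonneg ht hz.1).eq_or_lt with h | h
    · rw [← h]; simp
    · rw [Real.rpow_def_of_pos h]
      congr 1
      ring
  simp only [e, genIdProfile, genIdWeight, div_eq_mul_inv, mul_inv]
  ring

theorem IsAdmissibleExponent.continuousOn_genIdProfile (hα : IsAdmissibleExponent T α)
    (hα1 : iteratedDerivWithin 1 α (Icc 0 T) 0 = 0)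
    (hα2 : iteratedDerivWithin 2 α (Icc 0 T) 0 = 0) :
    ContinuousOn (genIdProfile α) (Icc 0 T) := by
  refine ContinuousOn.mul (hα.continuousOn_mul_log hα1 hα2).neg.rexp ?_
  exact contDiff_inv_Gamma.continuous.comp_continuousOn
    (continuousOn_const.sub hα.continuousOn)

theorem IsAdmissibleExponent.hasBoundedSecondDeriv_genIdProfile (hα : IsAdmissibleExponent T α)
    (hα1 : iteratedDerivWithin 1 α (Icc 0 T) 0 = 0)
    (hα2 : iteratedDerivWithin 2 α (Icc 0 T) 0 = 0) :
    HasBoundedSecondDeriv T (genIdProfile α) := by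
  have h1 := (hα.hasBoundedSecondDeriv_mul_log hα1 hα2).comp (R := fun y => Real.exp (-y))
    (by fun_prop)
  have h2 := (hα.hasBoundedSecondDeriv hα1 hα2).comp (R := fun y => (Real.Gamma (2 - y))⁻¹)
    (contDiff_inv_Gamma.comp (f := fun y : ℝ => 2 - y) (by fun_prop))
  exact h1.mul h2

theorem IsAdmissibleExponent.genIdProfile_pos (hα : IsAdmissibleExponent T α) {s : ℝ}
    (hs : s ∈ Icc 0 T) : 0 < genIdProfile α s := by
  have := Real.Gamma_pos_of_pos (show 0 < 2 - α s by linarith [(hα.mem_Ioo s hs).2])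
  unfold genIdProfile
  positivity

theorem mul_mem_Icc_of_mem_Icc_zero_one {t z : ℝ} (ht : t ∈ Icc 0 T) (hz : z ∈ Icc (0 : ℝ) 1) :
    t * z ∈ Icc 0 T :=
  ⟨mul_nonneg ht.1 hz.1, (mul_le_of_le_one_right ht.1 hz.2).trans ht.2⟩

theorem IsAdmissibleExponent.intervalIntegrable_genId (hα : IsAdmissibleExponent T α)
    (hα1 : iteratedDerivWithin 1 α (Icc 0 T) 0 = 0)
    (hα2 : iteratedDerivWithin 2 α (Icc 0 T) 0 = 0) {t : ℝ} (ht : t ∈ Icc 0 T) :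
    IntervalIntegrable (fun z => genIdProfile α (t * z) * genIdWeight (α 0) z) volume 0 1 := by
  have h0 := hα.mem_Ioo 0 ⟨le_rfl, ht.1.trans ht.2⟩
  refine (intervalIntegrable_genIdWeight h0.1 h0.2).continuousOn_mul ?_
  rw [uIcc_of_le zero_le_one]
  exact (hα.continuousOn_genIdProfile hα1 hα2).comp (by fun_prop) fun z hz =>
    mul_mem_Icc_of_mem_Icc_zero_one ht hz

theorem IsAdmissibleExponent.genId_zero (hT : 0 < T) (hα : IsAdmissibleExponent T α) :
    genId α 0 = 1 := by
  have h0 := hα.mem_Ioo 0 ⟨le_rfl, hT.le⟩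
  rw [genId_eq_integral α le_rfl]
  simp only [zero_mul]
  rw [intervalIntegral.integral_const_mul, integral_genIdWeight h0.1 h0.2, genIdProfile]
  have hG : Real.Gamma (2 - α 0) ≠ 0 := (Real.Gamma_pos_of_pos (by linarith [h0.2])).ne'
  simp [hG]

theorem IsAdmissibleExponent.genId_pos (hα : IsAdmissibleExponent T α)
    (hα1 : iteratedDerivWithin 1 α (Icc 0 T) 0 = 0)
    (hα2 : iteratedDerivWithin 2 α (Icc 0 T) 0 = 0) {t : ℝ} (ht : t ∈ Icc 0 T) :
    0 < genId α t := by
  have h0 := hα.mem_Ioo 0 ⟨le_rfl, ht.1.trans ht.2⟩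
  rw [genId_eq_integral α ht.1]
  refine intervalIntegral.intervalIntegral_pos_of_pos_on
    (hα.intervalIntegrable_genId hα1 hα2 ht) (fun z hz => ?_) zero_lt_one
  exact mul_pos (hα.genIdProfile_pos
    (mul_mem_Icc_of_mem_Icc_zero_one ht (Ioo_subset_Icc_self hz))) (genIdWeight_pos h0.1 hz)

/-- First and second differences of `genId`. -/
theorem IsAdmissibleExponent.exists_genId_difference_bound (hT : 0 < T)
    (hα : IsAdmissibleExponent T α) (hα1 : iteratedDerivWithin 1 α (Icc 0 T) 0 = 0)
    (hα2 : iteratedDerivWithin 2 α (Icc 0 T) 0 = 0) :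
    ∃ C : ℝ, 0 ≤ C ∧
      (∀ s h, 0 ≤ s → 0 ≤ h → s + h ≤ T → |genId α (s + h) - genId α s| ≤ C * h) ∧
      ∀ s h, 0 ≤ s → 0 ≤ h → s + 2 * h ≤ T →
        |genId α (s + 2 * h) - 2 * genId α (s + h) + genId α s| ≤ C * h ^ 2 := by
  obtain ⟨C, hC, hd1, hd2⟩ :=
    (hα.hasBoundedSecondDeriv_genIdProfile hα1 hα2).exists_difference_bound
      (hα.continuousOn_genIdProfile hα1 hα2)
  have h0 := hα.mem_Ioo 0 ⟨le_rfl, hT.le⟩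
  have hG : 0 < Real.Gamma (2 - α 0) := Real.Gamma_pos_of_pos (by linarith [h0.2])
  have hint : ∀ t, 0 ≤ t → t ≤ T →
      IntervalIntegrable (fun z => genIdProfile α (t * z) * genIdWeight (α 0) z) volume 0 1 :=
    fun t h1 h2 => hα.intervalIntegrable_genId hα1 hα2 ⟨h1, h2⟩
  -- The weight is nonnegative with total mass `Γ(2 - α(0))`, so difference bounds for the profile
  -- pass to `g`; the increments `h z` in the argument are at most `h`.
  have hbound : ∀ (F : ℝ → ℝ) (B : ℝ),
      (∀ z ∈ Icc (0 : ℝ) 1, |F z| ≤ B * genIdWeight (α 0) z) →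
      |∫ z in (0 : ℝ)..1, F z| ≤ B * Real.Gamma (2 - α 0) := by
    intro F B hF
    rw [← Real.norm_eq_abs]
    rw [← integral_genIdWeight h0.1 h0.2, ← intervalIntegral.integral_const_mul]
    refine intervalIntegral.norm_integral_le_of_norm_le zero_le_one
      (Eventually.of_forall fun z hz => hF z (Ioc_subset_Icc_self hz))
      ((intervalIntegrable_genIdWeight h0.1 h0.2).const_mul B)
  refine ⟨C * Real.Gamma (2 - α 0), by positivity, fun s h hs hh hsT => ?_,
    fun s h hs hh hsT => ?_⟩
  · rw [genId_eq_integral α hs, genId_eq_integral α (by linarith),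
      ← intervalIntegral.integral_sub (hint _ (by linarith) hsT) (hint _ hs (by linarith))]
    refine (hbound _ (C * h) fun z hz => ?_).trans (le_of_eq (by ring))
    have hw := genIdWeight_nonneg h0.1 hz
    rw [← sub_mul, abs_mul, abs_of_nonneg hw, add_mul]
    refine mul_le_mul_of_nonneg_right ?_ hw
    refine (hd1 (s * z) (h * z) (mul_nonneg hs hz.1) (mul_nonneg hh hz.1) ?_).trans ?_
    · rw [← add_mul]
      exact (mul_mem_Icc_of_mem_Icc_zero_one ⟨by linarith, hsT⟩ hz).2
    · exact mul_le_mul_of_nonneg_left (mul_le_of_le_one_right hh hz.2) hC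
  · rw [genId_eq_integral α hs, genId_eq_integral α (by linarith : 0 ≤ s + h),
      genId_eq_integral α (by linarith : 0 ≤ s + 2 * h), ← intervalIntegral.integral_const_mul,
      ← intervalIntegral.integral_sub (hint _ (by linarith) hsT)
        ((hint _ (by linarith) (by linarith)).const_mul 2),
      ← intervalIntegral.integral_add ((hint _ (by linarith) hsT).sub
        ((hint _ (by linarith) (by linarith)).const_mul 2)) (hint _ hs (by linarith))]
    refine (hbound _ (C * h ^ 2) fun z hz => ?_).trans (le_of_eq (by ring))
    have hw := genIdWeight_nonneg h0.1 hz
    have e : genIdProfile α ((s + 2 * h) * z) * genIdWeight (α 0) z -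
        2 * (genIdProfile α ((s + h) * z) * genIdWeight (α 0) z) +
        genIdProfile α (s * z) * genIdWeight (α 0) z =
        (genIdProfile α (s * z + 2 * (h * z)) - 2 * genIdProfile α (s * z + h * z) +
          genIdProfile α (s * z)) * genIdWeight (α 0) z := by
      rw [show (s + 2 * h) * z = s * z + 2 * (h * z) by ring, add_mul s h z]
      ring
    rw [e, abs_mul, abs_of_nonneg hw]
    refine mul_le_mul_of_nonneg_right ?_ hw
    refine (hd2 (s * z) (h * z) (mul_nonneg hs hz.1) (mul_nonneg hh hz.1) ?_).trans ?_
    · rw [show s * z + 2 * (h * z) = (s + 2 * h) * z by ring]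
      exact (mul_mem_Icc_of_mem_Icc_zero_one ⟨by linarith, hsT⟩ hz).2
    · exact mul_le_mul_of_nonneg_left
        (pow_le_pow_left₀ (mul_nonneg hh hz.1) (mul_le_of_le_one_right hh hz.2) 2) hC

end GenId

/-! ### The right-hand side -/

section Rhs

variable {d : ℕ} {Ω : Set (EuclideanSpace ℝ (Fin d))} {T κ : ℝ} {α : ℝ → ℝ}

theorem norm_integral_abelKernel_smul_le {E : Type*} [NormedAddCommGroup E] [NormedSpace ℝ E]
    {μ t B : ℝ} (hμ : 0 < μ) (ht : 0 ≤ t) {f : ℝ → E} (hf : ∀ s ∈ Icc 0 t, ‖f s‖ ≤ B) :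
    ‖∫ s in (0 : ℝ)..t, abelKernel μ (t - s) • f s‖ ≤ t ^ μ / (μ * Real.Gamma μ) * B := by
  have hG := Real.Gamma_pos_of_pos hμ
  have hint : IntervalIntegrable (fun s => abelKernel μ (t - s) * B) volume 0 t := by
    have h := (intervalIntegral.intervalIntegrable_rpow' (a := 0) (b := t)
      (show -1 < μ - 1 by linarith)).comp_sub_left t
    rw [sub_zero, sub_self] at h
    exact ((h.symm).div_const _).mul_const B
  refine (intervalIntegral.norm_integral_le_of_norm_le ht
    (Eventually.of_forall fun s hs => ?_) hint).trans (le_of_eq ?_)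
  · have hk : 0 ≤ abelKernel μ (t - s) :=
      div_nonneg (Real.rpow_nonneg (sub_nonneg.2 hs.2) _) hG.le
    rw [norm_smul, Real.norm_eq_abs, abs_of_nonneg hk]
    exact mul_le_mul_of_nonneg_left (hf s (Ioc_subset_Icc_self hs)) hk
  · rw [intervalIntegral.integral_mul_const,
      intervalIntegral.integral_comp_sub_left (fun x => abelKernel μ x), sub_self, sub_zero]
    simp only [abelKernel]
    rw [intervalIntegral.integral_div, integral_rpow (Or.inl (by linarith)), sub_add_cancel,
      Real.zero_rpow hμ.ne', sub_zero, div_div]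

theorem exists_norm_rhs_le (hT : 0 < T) (hκ : 0 < κ) (hα : IsAdmissibleExponent T α)
    (hα1 : iteratedDerivWithin 1 α (Icc 0 T) 0 = 0)
    (hα2 : iteratedDerivWithin 2 α (Icc 0 T) 0 = 0) :
    ∃ B : ℝ, 0 < B ∧ ∀ (Au₀ ubar₀ : L2 Ω) (f : ℝ → L2 Ω) (t S : ℝ), t ∈ Icc 0 T →
      (∀ s ∈ Icc 0 t, ‖f s‖ ≤ S) →
      ‖rhs κ α Au₀ ubar₀ f t‖ ≤ B * (‖Au₀‖ + ‖ubar₀‖ + S) := by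
  obtain ⟨C, hC, hC1, -⟩ := hα.exists_genId_difference_bound hT hα1 hα2
  set μ := α 0 - 1 with hμ
  have hμ0 : 0 < μ := by linarith [(hα.mem_Ioo 0 ⟨le_rfl, hT.le⟩).1]
  have hG := Real.Gamma_pos_of_pos hμ0
  have hTμ : 0 < T ^ μ := Real.rpow_pos_of_pos hT μ
  set P := T ^ μ / (μ * Real.Gamma μ) with hP
  have hP0 : 0 < P := by positivity
  refine ⟨P * (κ + 1) + (1 + C * T), by positivity, fun Au₀ ubar₀ f t S ht hS => ?_⟩
  have hS0 : 0 ≤ S := (norm_nonneg _).trans (hS 0 ⟨le_rfl, ht.1⟩)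
  have h1 : ‖∫ s in (0 : ℝ)..t, abelKernel μ (t - s) • (κ • Au₀ + f s)‖ ≤
      P * (κ * ‖Au₀‖ + S) := by
    refine (norm_integral_abelKernel_smul_le (B := κ * ‖Au₀‖ + S) hμ0 ht.1 fun s hs => ?_).trans ?_
    · refine (norm_add_le _ _).trans (add_le_add ?_ (hS s hs))
      rw [norm_smul, Real.norm_eq_abs, abs_of_pos hκ]
    · refine mul_le_mul_of_nonneg_right ?_ (by positivity)
      exact div_le_div_of_nonneg_right (Real.rpow_le_rpow ht.1 ht.2 hμ0.le) (by positivity)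
  have h2 : ‖genId α t • ubar₀‖ ≤ (1 + C * T) * ‖ubar₀‖ := by
    rw [norm_smul, Real.norm_eq_abs]
    refine mul_le_mul_of_nonneg_right ?_ (norm_nonneg _)
    -- The first difference from `0` and `g(0) = 1` give `|g| ≤ 1 + C T`.
    have h3 := hC1 0 t le_rfl ht.1 (by linarith [ht.2])
    rw [zero_add, hα.genId_zero hT] at h3
    have h4 : C * t ≤ C * T := mul_le_mul_of_nonneg_left ht.2 hC
    have h5 := abs_sub_abs_le_abs_sub (genId α t) 1
    rw [abs_one] at h5
    linarith
  refine (norm_add_le _ _).trans ((add_le_add h1 h2).trans ?_)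
  have e : (P * (κ + 1) + (1 + C * T)) * (‖Au₀‖ + ‖ubar₀‖ + S) =
      P * (κ * ‖Au₀‖ + S) + (1 + C * T) * ‖ubar₀‖ + (P * (‖Au₀‖ + κ * ‖ubar₀‖ + ‖ubar₀‖ + κ * S) +
        (1 + C * T) * (‖Au₀‖ + S)) := by ring
  rw [e]
  have : 0 ≤ P * (‖Au₀‖ + κ * ‖ubar₀‖ + ‖ubar₀‖ + κ * S) + (1 + C * T) * (‖Au₀‖ + S) := by
    positivity
  linarith

/-- Stability of the scheme for an arbitrary right-hand side. -/
theorem exists_scheme_stability (hΩ : IsOpen Ω) (hT : 0 < T) (hκ : 0 < κ)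
    (hα : IsAdmissibleExponent T α) (hα1 : iteratedDerivWithin 1 α (Icc 0 T) 0 = 0)
    (hα2 : iteratedDerivWithin 2 α (Icc 0 T) 0 = 0) :
    ∃ Q : ℝ, 0 < Q ∧ ∀ (N : ℕ), 1 ≤ N → ∀ (F : ℝ → L2 Ω) (U AU : ℕ → L2 Ω),
      IsSchemeSolution Ω T κ α N F U AU → ∀ m, 1 ≤ m → m ≤ N →
        ‖U m‖ ≤ Q * ∑ n ∈ Finset.Icc 1 m, (T / N) * ‖F (n * (T / N))‖ := by
  obtain ⟨C, hC, hC1, hC2⟩ := hα.exists_genId_difference_bound hT hα1 hα2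
  have hα0 := hα.mem_Ioo 0 ⟨le_rfl, hT.le⟩
  have hnorm : ∀ (N : ℕ) (F : ℝ → L2 Ω) (m : ℕ),
      ∑ n ∈ Finset.Icc 1 m, (T / N) * ‖F (n * (T / N))‖ =
        ∑ n ∈ Finset.Icc 1 m, ‖(T / N) • F (n * (T / N))‖ := by
    intro N F m
    refine Finset.sum_congr rfl fun n _ => ?_
    rw [norm_smul, Real.norm_eq_abs, abs_of_nonneg (by positivity)]
  have hfix : ∀ N : ℕ, ∃ K : ℝ, 0 ≤ K ∧ (1 ≤ N → ∀ (F : ℝ → L2 Ω) (U AU : ℕ → L2 Ω),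
      IsSchemeSolution Ω T κ α N F U AU → ∀ m, 1 ≤ m → m ≤ N →
        ‖U m‖ ≤ K * ∑ n ∈ Finset.Icc 1 m, (T / N) * ‖F (n * (T / N))‖) := by
    intro N
    rcases Nat.eq_zero_or_pos N with rfl | hN
    · exact ⟨0, le_rfl, fun h => by omega⟩
    have hN' : (1 : ℝ) ≤ N := by exact_mod_cast hN
    have hτT : T / N ∈ Icc 0 T := ⟨by positivity, div_le_self hT.le hN'⟩
    have hw0 : wgt α (T / N) 0 = genId α (T / N) - 1 := by
      simp [wgt, hα.genId_zero hT]
    -- The diagonal coefficients are `1 + w_0` and `3/2 + w_0` with `w_0 = g(τ) - 1`, hence at least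
    -- `g(τ) > 0`.
    have hg := hα.genId_pos hα1 hα2 hτT
    obtain ⟨K, hK, h⟩ := stability_of_fixed_length (L2 Ω)
      (fun n k => startedBdf2Coeff n k + abelWeight (wgt α (T / N)) (n - k))
      (cqWeight_zero_pos (α 0 - 1)) N (fun n h1 h2 => by
        simp only [startedBdf2Coeff, abelWeight, Nat.sub_self, if_true, hw0]
        split_ifs <;> first | omega | linarith)
    refine ⟨K, hK, fun _ F U AU hU m hm hmN => ?_⟩
    rw [hnorm]
    refine h (T / N * (κ * (T / N) ^ (α 0 - 1))) U AU (fun n => (T / N) • F (n * (T / N)))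
      (by positivity) hU.dissipative (fun n hn hnN => ?_) m hm hmN
    rw [← hU.scaled_equation hΩ hT hN n hn hnN, startedBdf2_eq_sum hU.initial hn]
    simp only [add_smul, Finset.sum_add_distrib]
  choose K hK hKs using hfix
  -- For `N ≥ N₀` the step `τ = T / N` meets the smallness condition `8 C (1 + T) τ ≤ 1`. The
  -- finitely many smaller `N` are covered by the sum of their constants `K N`.
  set N₀ := ⌈8 * (C * (1 + T) * T)⌉₊ with hN₀
  have hKsum : 0 ≤ ∑ N ∈ Finset.range N₀, K N := Finset.sum_nonneg fun N _ => hK N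
  set Q₀ := 12 * Real.exp (8 * (C * (1 + T) * T)) with hQ₀
  have hQ₀pos : 0 < Q₀ := by positivity
  refine ⟨Q₀ + ∑ N ∈ Finset.range N₀, K N, by positivity, fun N hN F U AU hU m hm hmN => ?_⟩
  have hS0 : 0 ≤ ∑ n ∈ Finset.Icc 1 m, (T / N) * ‖F (n * (T / N))‖ :=
    Finset.sum_nonneg fun n _ => by positivity
  rcases lt_or_ge N N₀ with hlt | hge
  · refine (hKs N hN F U AU hU m hm hmN).trans (mul_le_mul_of_nonneg_right ?_ hS0)
    have := Finset.single_le_sum (f := K) (fun i _ => hK i) (Finset.mem_range.2 hlt)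
    linarith
  · refine le_trans ?_ (mul_le_mul_of_nonneg_right (le_add_of_nonneg_right hKsum) hS0)
    have hN' : (0 : ℝ) < N := by exact_mod_cast hN
    have hτ : 0 ≤ T / N := by positivity
    have hNτ : (N : ℝ) * (T / N) = T := by field_simp
    rw [hnorm]
    refine stability_of_small_step (w := wgt α (T / N)) (χ := cqWeight (α 0 - 1)) (τ := T / N)
      (c := T / N * (κ * (T / N) ^ (α 0 - 1))) (AU := AU)
      hτ hNτ.le hC ?_ (fun k hk => ?_) ?_ (by positivity) hU.initial
      (hU.conv_inner_nonpos (by linarith [hα0.1]) (by linarith [hα0.2]))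
      (hU.scaled_equation hΩ hT hN) m hm hmN
    · have := hC1 0 (T / N) le_rfl hτ (by
        rw [zero_add]; exact div_le_self hT.le (by exact_mod_cast hN))
      simpa [wgt] using this
    · have h1 : (k : ℝ) * (T / N) + 2 * (T / N) ≤ T := by
        rw [← add_mul]
        exact (mul_le_mul_of_nonneg_right (by exact_mod_cast hk) hτ).trans hNτ.le
      have h2 := hC2 (k * (T / N)) (T / N) (by positivity) hτ h1
      refine le_trans (le_of_eq ?_) h2
      simp only [wgt]
      push_cast
      rw [show ((k : ℝ) + 1 + 1) * (T / N) = k * (T / N) + 2 * (T / N) by ring,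
        show ((k : ℝ) + 1) * (T / N) = k * (T / N) + T / N by ring]
      congr 1
      ring
    · have h1 : 8 * (C * (1 + T) * T) ≤ N := (Nat.le_ceil _).trans (by exact_mod_cast hge)
      rw [show 8 * (C * (1 + T) * (T / N)) = 8 * (C * (1 + T) * T) / N by ring]
      exact (div_le_one hN').2 h1

end Rhs

end VarExpWave

/-! ### The stability theorem -/

theorem mainTheorem7
    {d : ℕ} (Ω : Set (EuclideanSpace ℝ (Fin d))) (hΩ : IsOpen Ω) (hΩb : Bornology.IsBounded Ω)
    (T : ℝ) (hT : 0 < T) (κ : ℝ) (hκ : 0 < κ)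
    (α : ℝ → ℝ) (hα : VarExpWave.IsAdmissibleExponent T α)
    (hα1 : iteratedDerivWithin 1 α (Set.Icc 0 T) 0 = 0)
    (hα2 : iteratedDerivWithin 2 α (Set.Icc 0 T) 0 = 0) :
    ∃ Q₁ Q₂ : ℝ, 0 < Q₁ ∧ 0 < Q₂ ∧
      ∀ (u₀ Au₀ ubar₀ : VarExpWave.L2 Ω) (f : ℝ → VarExpWave.L2 Ω),
        VarExpWave.IsDirichletLaplacian Ω u₀ Au₀ →
        ContinuousOn f (Set.Icc 0 T) →
        ∀ (N : ℕ), 1 ≤ N →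
        ∀ (U AU : ℕ → VarExpWave.L2 Ω),
          VarExpWave.IsSchemeSolution Ω T κ α N (VarExpWave.rhs κ α Au₀ ubar₀ f) U AU →
          ∀ m : ℕ, 1 ≤ m → m ≤ N →
            ‖U m‖ ≤ Q₁ * ∑ n ∈ Finset.Icc 1 m,
                (T / N) * ‖VarExpWave.rhs κ α Au₀ ubar₀ f (n * (T / N))‖ ∧
            Q₁ * ∑ n ∈ Finset.Icc 1 m,
                (T / N) * ‖VarExpWave.rhs κ α Au₀ ubar₀ f (n * (T / N))‖ ≤
              Q₂ * (‖Au₀‖ + ‖ubar₀‖ +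
                sSup ((fun t => ‖f t‖) '' Set.Icc 0 (m * (T / N)))) := by
  obtain ⟨Q, hQ, hstab⟩ := VarExpWave.exists_scheme_stability hΩ hT hκ hα hα1 hα2
  obtain ⟨B, hB, hrhs⟩ := VarExpWave.exists_norm_rhs_le (Ω := Ω) hT hκ hα hα1 hα2
  -- The factor `B` bounds each `𝓕(t_n)`, and `T` bounds the total length `m τ`.
  refine ⟨Q, Q * (T * B), hQ, by positivity, ?_⟩
  intro u₀ Au₀ ubar₀ f _ hf N hN U AU hU m hm hmN
  refine ⟨hstab N hN _ U AU hU m hm hmN, ?_⟩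
  have hN' : (0 : ℝ) < N := by exact_mod_cast hN
  have hτ : 0 ≤ T / N := by positivity
  have hmT : (m : ℝ) * (T / N) ≤ T := by
    calc (m : ℝ) * (T / N) ≤ N * (T / N) :=
          mul_le_mul_of_nonneg_right (by exact_mod_cast hmN) hτ
      _ = T := by field_simp
  set S := sSup ((fun t => ‖f t‖) '' Set.Icc 0 (m * (T / N))) with hS
  have hfS : ∀ s ∈ Icc 0 ((m : ℝ) * (T / N)), ‖f s‖ ≤ S := fun s hs => by
    refine le_csSup ?_ (mem_image_of_mem _ hs)
    exact (isCompact_Icc.image_of_continuousOn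
      (hf.mono (Icc_subset_Icc le_rfl hmT)).norm).bddAbove
  have hS0 : 0 ≤ S := (norm_nonneg _).trans (hfS 0 ⟨le_rfl, by positivity⟩)
  have hterm : ∀ n ∈ Finset.Icc 1 m,
      (T / N) * ‖VarExpWave.rhs κ α Au₀ ubar₀ f (n * (T / N))‖ ≤
        (T / N) * (B * (‖Au₀‖ + ‖ubar₀‖ + S)) := fun n hn => by
    rw [Finset.mem_Icc] at hn
    have hnm : (n : ℝ) * (T / N) ≤ m * (T / N) :=
      mul_le_mul_of_nonneg_right (by exact_mod_cast hn.2) hτ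
    exact mul_le_mul_of_nonneg_left (hrhs Au₀ ubar₀ f _ S ⟨by positivity, hnm.trans hmT⟩
      fun s hs => hfS s ⟨hs.1, hs.2.trans hnm⟩) hτ
  rw [mul_assoc]
  refine mul_le_mul_of_nonneg_left ((Finset.sum_le_sum hterm).trans ?_) hQ.le
  rw [Finset.sum_const, Nat.card_Icc, Nat.add_sub_cancel, nsmul_eq_mul, ← mul_assoc, mul_assoc T]
  exact mul_le_mul_of_nonneg_right hmT (by positivity)
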